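/- Let $N\ge 0$ be an integer, $h=1/(2N+1)$, and consider real grid functions $f=(f_{i,j})_{0\le i,j\le 2N}$ on the uniform periodic grid $x_i=ih$, $y_j=jh$ of the unit torus. With the discrete Fourier coefficients $\hat f_{k,l}=h^2\sum_{i,j=0}^{2N} f_{i,j}e^{-2\pi \mathrm i(kx_i+ly_j)}$, $-N\le k,l\le N$, let $(\mathcal D_{x}f)_{i,j}=\sum_{k,l=-N}^{N}2\pi \mathrm i k\,\hat f_{k,l}e^{2\pi \mathrm i(kx_i+ly_j)}$ and $(\mathcal D_{x}^2f)_{i,j}=\sum_{k,l=-N}^{N}(-4\pi^2k^2)\hat f_{k,l}e^{2\pi \mathrm i(kx_i+ly_j)}$, similarly in $y$, and put $\nabla_N=(\mathcal D_x,\mathcal D_y)$, $\nabla_N\cdot(g_1,g_2)=\mathcal D_xg_1+\mathcal D_yg_2$, $\Delta_N=\mathcal D_x^2+\mathcal D_y^2$. Let $\|f\|_2^2=h^2\sum_{i,j}f_{i,j}^2$, $\|f\|_{H^1}=\|\nabla_Nf\|_2$, $\|f\|_{H^2}=\|\Delta_Nf\|_2$ (these equal the $L^2$ norms over the unit torus of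 the trigonometric interpolant of $f$, of its gradient and of its Laplacian). Let $\nu>0$, $\Delta t>0$, and let $\omega^n,\psi^n,\boldsymbol u^n$ ($n\ge 0$) be grid functions solving the Fourier collocation scheme $$\frac{\omega^{n+1}-\omega^n}{\Delta t}+\tfrac12\bigl(\boldsymbol u^n\cdot\nabla_N\omega^n+\nabla_N\cdot(\boldsymbol u^n\omega^n)\bigr)=\nu\Delta_N\omega^{n+1}+f^n,\qquad -\Delta_N\psi^n=\omega^n,\qquad \boldsymbol u^n=(-\mathcal D_y\psi^n,\mathcal D_x\psi^n),$$ where $\omega^0$, $\psi^n$ and the forcing $f^n$ have mean zero over the grid, and $\|f^n\|_2\le F$ for all $n\ge0$. Let $c_0=1/(2\pi)$ be the Poincaré constant of the unit torus and $\theta=\bigl(1+\frac{\nu}{2c_0^2}\Delta t\bigr)^{-1}$. Then there are an absolute constant $C_w\ge1$ and constants $M_0=M_0(\|\omega^0\|_{H^1},\nu,F)>0$, $A=A(\|\omega^0\|_2,\nu,F)$, $K=K(\|\omega^0\|_2,\nu,F)$ and $B=B(\nu,F)$, none of which depends on $N$, $\Delta t$, $n$, such that, if $$\Delta t\le\frac{\nu}{4C_w^2M_0^2},$$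 then for all $n\ge0$ $$\|\omega^n\|_2\le M_0,\qquad \|\omega^n\|_{H^1}\le M_0,$$ $$\|\omega^n\|_2^2\le\theta^n\|\omega^0\|_2^2+\frac{2c_0^4}{\nu^2}F^2(1-\theta^n),$$ $$\|\omega^n\|_{H^1}^2\le\theta^n\|\omega^0\|_{H^1}^2+(B+\theta^nA)(1-\theta^n),$$ and for all integers $1\le i\le m$ $$\frac\nu2\Delta t\sum_{n=i}^m\|\omega^n\|_{H^1}^2\le\|\omega^{i-1}\|_2^2+\frac{c_0^2}{\nu}F^2(m-i+1)\Delta t,$$ $$\frac\nu2\Delta t\sum_{n=i}^m\|\omega^n\|_{H^2}^2\le\|\omega^{i-1}\|_{H^1}^2+K\,(m-i+1)\Delta t.$$ -/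

import Mathlib

namespace CollocNS

open Complex Finset

noncomputable section

/-- Real grid functions on the uniform periodic grid with `(2N+1) × (2N+1)` nodes of the unit
square. -/
abbrev Grid (N : ℕ) : Type := Fin (2 * N + 1) → Fin (2 * N + 1) → ℝ

/-- The mesh size `h = 1 / (2N+1)`. -/
def mesh (N : ℕ) : ℝ := 1 / (2 * (N : ℝ) + 1)

/-- The one-dimensional nodes `x_i = i h`. -/
def node (N : ℕ) (i : Fin (2 * N + 1)) : ℝ := (i : ℕ) * mesh N

/-- The one-dimensional Fourier mode `exp (2 π i k x)`. -/
def mode (k : ℤ) (x : ℝ) : ℂ := exp (2 * Real.pi * I * k * x)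

/-- The frequencies `-N, …, N`. -/
def freq (N : ℕ) : Finset ℤ := Finset.Icc (-(N : ℤ)) N

/-- The discrete Fourier (interpolation) coefficients of a grid function. -/
def coeff {N : ℕ} (f : Grid N) (k l : ℤ) : ℂ :=
  (mesh N : ℂ) ^ 2 * ∑ i, ∑ j, (f i j : ℂ) * (mode (-k) (node N i) * mode (-l) (node N j))

/-- The trigonometric polynomial obtained from the Fourier interpolant of `f` by multiplying
the coefficient of frequency `(k, l)` by `m k l`. -/
def fourierSum {N : ℕ} (m : ℤ → ℤ → ℂ) (f : Grid N) (x y : ℝ) : ℂ :=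
  ∑ k ∈ freq N, ∑ l ∈ freq N, m k l * coeff f k l * (mode k x * mode l y)

/-- Collocation derivative in `x` (the Fourier sum is real, see `fourierSum_im`). -/
def Dx {N : ℕ} (f : Grid N) : Grid N := fun i j =>
  (fourierSum (fun k _ => 2 * Real.pi * I * k) f (node N i) (node N j)).re

/-- Collocation derivative in `y`. -/
def Dy {N : ℕ} (f : Grid N) : Grid N := fun i j =>
  (fourierSum (fun _ l => 2 * Real.pi * I * l) f (node N i) (node N j)).re

/-- Collocation second derivative in `x`. -/
def Dxx {N : ℕ} (f : Grid N) : Grid N := fun i j =>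
  (fourierSum (fun k _ => -(4 * Real.pi ^ 2 * (k : ℂ) ^ 2)) f (node N i) (node N j)).re

/-- Collocation second derivative in `y`. -/
def Dyy {N : ℕ} (f : Grid N) : Grid N := fun i j =>
  (fourierSum (fun _ l => -(4 * Real.pi ^ 2 * (l : ℂ) ^ 2)) f (node N i) (node N j)).re

/-- The discrete Laplacian. -/
def lap {N : ℕ} (f : Grid N) : Grid N := fun i j => Dxx f i j + Dyy f i j

/-- The discrete `L²` inner product. -/
def inner2 {N : ℕ} (f g : Grid N) : ℝ := mesh N ^ 2 * ∑ i, ∑ j, f i j * g i j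

/-- The discrete `L²` norm. -/
def normL2 {N : ℕ} (f : Grid N) : ℝ := Real.sqrt (inner2 f f)

/-- The discrete (homogeneous) `H¹` norm: the discrete `L²` norm of the discrete gradient. -/
def normH1 {N : ℕ} (f : Grid N) : ℝ := Real.sqrt (inner2 (Dx f) (Dx f) + inner2 (Dy f) (Dy f))

/-- The discrete (homogeneous) `H²` norm: the discrete `L²` norm of the discrete Laplacian. -/
def normH2 {N : ℕ} (f : Grid N) : ℝ := normL2 (lap f)

/-- Grid functions with zero mean. -/
def MeanZero {N : ℕ} (f : Grid N) : Prop := ∑ i, ∑ j, f i j = 0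

/-- `(ω, ψ, (u, v))` solves the fully discrete first order semi-implicit Fourier collocation
scheme with the skew-symmetric nonlinear term, viscosity `ν`, time step `dt` and forcing `f`. -/
structure IsSolution {N : ℕ} (ν dt : ℝ) (f ω ψ u v : ℕ → Grid N) : Prop where
  vorticity : ∀ n i j,
    (ω (n + 1) i j - ω n i j) / dt
      + 1 / 2 * ((u n i j * Dx (ω n) i j + v n i j * Dy (ω n) i j)
        + (Dx (fun a b => u n a b * ω n a b) i j + Dy (fun a b => v n a b * ω n a b) i j))
      = ν * lap (ω (n + 1)) i j + f n i j
  stream : ∀ n i j, -lap (ψ n) i j = ω n i j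
  stream_mean : ∀ n, MeanZero (ψ n)
  velocity_x : ∀ n i j, u n i j = -Dy (ψ n) i j
  velocity_y : ∀ n i j, v n i j = Dx (ψ n) i j

/-- The sharp constant in the Poincaré inequality for mean zero functions on the unit torus. -/
def c0 : ℝ := 1 / (2 * Real.pi)

/-- The decay factor `(1 + ν dt / (2 c0²))⁻¹` of one time step. -/
def decay (ν dt : ℝ) : ℝ := (1 + ν / (2 * c0 ^ 2) * dt)⁻¹

/-- The Fourier interpolant of a grid function: its continuous version. -/
def interp {N : ℕ} (f : Grid N) (x y : ℝ) : ℝ := (fourierSum (fun _ _ => 1) f x y).re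

/-- The `L²` norm of the interpolant over the unit torus. -/
def interpL2 {N : ℕ} (f : Grid N) : ℝ :=
  Real.sqrt (∫ x in (0 : ℝ)..1, ∫ y in (0 : ℝ)..1, interp f x y ^ 2)

/-- The `L²` norm of the gradient of the interpolant over the unit torus. -/
def interpH1 {N : ℕ} (f : Grid N) : ℝ :=
  Real.sqrt ((∫ x in (0 : ℝ)..1, ∫ y in (0 : ℝ)..1, deriv (fun s => interp f s y) x ^ 2)
    + ∫ x in (0 : ℝ)..1, ∫ y in (0 : ℝ)..1, deriv (fun s => interp f x s) y ^ 2)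

/-- The `L²` norm of the Laplacian of the interpolant over the unit torus. -/
def interpH2 {N : ℕ} (f : Grid N) : ℝ :=
  Real.sqrt (∫ x in (0 : ℝ)..1, ∫ y in (0 : ℝ)..1,
    (deriv (deriv (fun s => interp f s y)) x + deriv (deriv (fun s => interp f x s)) y) ^ 2)

/-! The collocation quantities agree with those of the interpolant. -/

lemma conj_mode (k : ℤ) (x : ℝ) : (starRingEnd ℂ) (mode k x) = mode (-k) x := by
  unfold mode
  rw [← exp_conj]
  congr 1
  simp only [map_mul, conj_I, conj_ofReal, map_ofNat, map_intCast]
  push_cast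
  ring

lemma conj_coeff {N : ℕ} (f : Grid N) (k l : ℤ) :
    (starRingEnd ℂ) (coeff f k l) = coeff f (-k) (-l) := by
  simp [coeff, conj_mode, map_sum]

lemma sum_freq_neg {N : ℕ} (g : ℤ → ℂ) : ∑ k ∈ freq N, g (-k) = ∑ k ∈ freq N, g k := by
  refine Finset.sum_nbij' (fun k => -k) (fun k => -k) ?_ ?_ ?_ ?_ ?_ <;>
    simp [freq] <;> intros <;> omega

/-- Fourier sums of real grid functions are real if the multiplier is Hermitian. -/
lemma fourierSum_im {N : ℕ} (m : ℤ → ℤ → ℂ)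
    (hm : ∀ k l, (starRingEnd ℂ) (m k l) = m (-k) (-l)) (f : Grid N) (x y : ℝ) :
    (fourierSum m f x y).im = 0 := by
  rw [← conj_eq_iff_im]
  unfold fourierSum
  simp only [map_sum, map_mul, hm, conj_coeff, conj_mode]
  rw [sum_freq_neg (fun k => ∑ l ∈ freq N,
    m k (-l) * coeff f k (-l) * (mode k x * mode (-l) y))]
  refine Finset.sum_congr rfl fun k _ => ?_
  exact sum_freq_neg (fun l => m k l * coeff f k l * (mode k x * mode l y))

lemma mode_add (k l : ℤ) (x : ℝ) : mode k x * mode l x = mode (k + l) x := by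
  unfold mode
  rw [← exp_add]
  congr 1
  push_cast
  ring

lemma mesh_mul (N : ℕ) : (mesh N : ℂ) * (2 * N + 1) = 1 := by
  have h : (2 * (N : ℂ) + 1) ≠ 0 := by exact_mod_cast (by omega : 2 * N + 1 ≠ 0)
  unfold mesh
  push_cast
  field_simp

lemma sum_mode {N : ℕ} (k : ℤ) (hk : |k| ≤ 2 * N) :
    (mesh N : ℂ) * ∑ i, mode k (node N i) = if k = 0 then 1 else 0 := by
  split_ifs with h0
  · subst h0
    have := mesh_mul N
    simpa [mode] using this
  · set z : ℂ := exp (2 * Real.pi * I * k * mesh N) with hz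
    have hM : ((2 * N + 1 : ℕ) : ℂ) ≠ 0 := by exact_mod_cast (by omega : 2 * N + 1 ≠ 0)
    have hpow : ∀ i : Fin (2 * N + 1), mode k (node N i) = z ^ (i : ℕ) := by
      intro i
      rw [hz, ← exp_nat_mul]
      unfold mode node
      congr 1
      push_cast
      ring
    have h1 : z ^ (2 * N + 1) = 1 := by
      rw [hz, ← exp_nat_mul, exp_eq_one_iff]
      refine ⟨k, ?_⟩
      have := mesh_mul N
      push_cast
      linear_combination (2 * Real.pi * I * k) * this
    have hne : z ≠ 1 := by
      intro h
      rw [hz, exp_eq_one_iff] at h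
      obtain ⟨n, hn⟩ := h
      have hpi : (2 * Real.pi * I : ℂ) ≠ 0 := by
        simp [Real.pi_ne_zero]
      have h2 : (k : ℂ) * mesh N = n := by
        apply mul_left_cancel₀ hpi
        linear_combination hn
      have h3 : (k : ℂ) = n * (2 * N + 1) := by
        linear_combination (2 * (N : ℂ) + 1) * h2 - (k : ℂ) * mesh_mul N
      have h4 : k = n * (2 * N + 1) := by exact_mod_cast h3
      have hn0 : n ≠ 0 := by
        rintro rfl
        simp at h4
        exact h0 h4
      have h5 : 1 ≤ |n| := Int.one_le_abs hn0
      have h6 : |k| = |n| * (2 * N + 1) := by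
        rw [h4, abs_mul, abs_of_nonneg (by positivity : (0 : ℤ) ≤ 2 * N + 1)]
      nlinarith
    simp only [hpow]
    rw [Fin.sum_univ_eq_sum_range (fun i => z ^ i), geom_sum_eq hne, h1]
    simp

/-- One-dimensional discrete Parseval identity. -/
lemma parseval_grid {N : ℕ} (b : ℤ → ℂ) :
    mesh N * ∑ i, ‖∑ k ∈ freq N, b k * mode k (node N i)‖ ^ 2
      = ∑ k ∈ freq N, ‖b k‖ ^ 2 := by
  have key : ∀ x : ℝ, ((‖∑ k ∈ freq N, b k * mode k x‖ ^ 2 : ℝ) : ℂ)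
      = ∑ k ∈ freq N, ∑ l ∈ freq N, b k * (starRingEnd ℂ) (b l) * mode (k + -l) x := by
    intro x
    push_cast
    rw [← mul_conj', map_sum, Finset.sum_mul_sum]
    refine Finset.sum_congr rfl fun k _ => Finset.sum_congr rfl fun l _ => ?_
    rw [map_mul, conj_mode, ← mode_add]
    ring
  apply ofReal_injective
  rw [ofReal_mul, ofReal_sum]
  simp only [key]
  rw [Finset.sum_comm, Finset.mul_sum, ofReal_sum]
  refine Finset.sum_congr rfl fun k hk => ?_
  rw [Finset.sum_comm, Finset.mul_sum]
  simp only [freq, Finset.mem_Icc] at hk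
  have : ∀ l ∈ freq N, (mesh N : ℂ) * ∑ i, b k * (starRingEnd ℂ) (b l) * mode (k + -l) (node N i)
      = if l = k then b k * (starRingEnd ℂ) (b l) else 0 := by
    intro l hl
    simp only [freq, Finset.mem_Icc] at hl
    rw [← Finset.mul_sum, mul_left_comm, sum_mode _ (by rw [abs_le]; omega)]
    by_cases h : l = k
    · simp [h]
    · rw [if_neg (by omega), if_neg h, mul_zero]
  rw [Finset.sum_congr rfl this, Finset.sum_ite_eq' , if_pos (by simp [freq, hk]), mul_conj']
  push_cast
  rfl

lemma integral_mode (k : ℤ) : ∫ x in (0 : ℝ)..1, mode k x = if k = 0 then 1 else 0 := by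
  split_ifs with h
  · subst h
    simp [mode]
  · have hc : (2 * Real.pi * I * k : ℂ) ≠ 0 := by
      simp [Real.pi_ne_zero, h]
    unfold mode
    rw [integral_exp_mul_complex hc]
    have : exp (2 * Real.pi * I * k * (1 : ℝ)) = 1 := by
      rw [exp_eq_one_iff]
      exact ⟨k, by push_cast; ring⟩
    rw [this]
    simp

lemma continuous_mode (k : ℤ) : Continuous (mode k) := by
  unfold mode
  fun_prop

lemma norm_sq_sum {N : ℕ} (b : ℤ → ℂ) (x : ℝ) :
    ((‖∑ k ∈ freq N, b k * mode k x‖ ^ 2 : ℝ) : ℂ)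
      = ∑ k ∈ freq N, ∑ l ∈ freq N, b k * (starRingEnd ℂ) (b l) * mode (k + -l) x := by
  push_cast
  rw [← mul_conj', map_sum, Finset.sum_mul_sum]
  refine Finset.sum_congr rfl fun k _ => Finset.sum_congr rfl fun l _ => ?_
  rw [map_mul, conj_mode, ← mode_add]
  ring

/-- One-dimensional Parseval identity. -/
lemma parseval_torus {N : ℕ} (b : ℤ → ℂ) :
    ∫ x in (0 : ℝ)..1, ‖∑ k ∈ freq N, b k * mode k x‖ ^ 2 = ∑ k ∈ freq N, ‖b k‖ ^ 2 := by
  apply ofReal_injective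
  rw [← intervalIntegral.integral_ofReal]
  simp only [norm_sq_sum]
  have hi : ∀ k l : ℤ, IntervalIntegrable
      (fun x => b k * (starRingEnd ℂ) (b l) * mode (k + -l) x) MeasureTheory.volume 0 1 :=
    fun k l => (continuous_const.mul (continuous_mode _)).intervalIntegrable _ _
  have hs : ∀ k ∈ freq N, IntervalIntegrable
      (fun x => ∑ l ∈ freq N, b k * (starRingEnd ℂ) (b l) * mode (k + -l) x)
      MeasureTheory.volume 0 1 := by
    intro k _
    have := continuous_mode
    exact Continuous.intervalIntegrable (by fun_prop) _ _
  rw [intervalIntegral.integral_finsetSum hs, ofReal_sum]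
  refine Finset.sum_congr rfl fun k hk => ?_
  rw [intervalIntegral.integral_finsetSum (fun l _ => hi k l)]
  have : ∀ l ∈ freq N, (∫ x in (0 : ℝ)..1, b k * (starRingEnd ℂ) (b l) * mode (k + -l) x)
      = if l = k then b k * (starRingEnd ℂ) (b l) else 0 := by
    intro l _
    rw [intervalIntegral.integral_const_mul, integral_mode]
    by_cases h : l = k
    · simp [h]
    · rw [if_neg (by omega), if_neg h, mul_zero]
  rw [Finset.sum_congr rfl this, Finset.sum_ite_eq', if_pos hk, mul_conj']
  push_cast
  rfl

/-- A Fourier sum as an iterated one-dimensional Fourier sum. -/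
lemma fourierSum_eq {N : ℕ} (m : ℤ → ℤ → ℂ) (f : Grid N) (x y : ℝ) :
    fourierSum m f x y
      = ∑ k ∈ freq N, (∑ l ∈ freq N, m k l * coeff f k l * mode l y) * mode k x := by
  unfold fourierSum
  refine Finset.sum_congr rfl fun k _ => ?_
  rw [Finset.sum_mul]
  exact Finset.sum_congr rfl fun l _ => by ring

lemma re_sq {z : ℂ} (h : z.im = 0) : z.re ^ 2 = ‖z‖ ^ 2 := by
  rw [← normSq_eq_norm_sq, normSq_apply, h]
  ring

lemma sum_grid_fourier {N : ℕ} (m : ℤ → ℤ → ℂ)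
    (hm : ∀ k l, (starRingEnd ℂ) (m k l) = m (-k) (-l)) (f : Grid N) :
    inner2 (fun i j => (fourierSum m f (node N i) (node N j)).re)
        (fun i j => (fourierSum m f (node N i) (node N j)).re)
      = ∑ k ∈ freq N, ∑ l ∈ freq N, ‖m k l * coeff f k l‖ ^ 2 := by
  unfold inner2
  simp only [← pow_two, re_sq (fourierSum_im m hm f _ _)]
  simp only [fourierSum_eq]
  rw [Finset.sum_comm, pow_two, mul_assoc, Finset.mul_sum]
  simp only [parseval_grid]
  rw [Finset.sum_comm, Finset.mul_sum]
  simp only [parseval_grid]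

lemma integral_fourier {N : ℕ} (m : ℤ → ℤ → ℂ)
    (hm : ∀ k l, (starRingEnd ℂ) (m k l) = m (-k) (-l)) (f : Grid N) :
    ∫ x in (0 : ℝ)..1, ∫ y in (0 : ℝ)..1, (fourierSum m f x y).re ^ 2
      = ∑ k ∈ freq N, ∑ l ∈ freq N, ‖m k l * coeff f k l‖ ^ 2 := by
  have h1 : ∀ x : ℝ, ∫ y in (0 : ℝ)..1, (fourierSum m f x y).re ^ 2
      = ∑ l ∈ freq N, ‖∑ k ∈ freq N, m k l * coeff f k l * mode k x‖ ^ 2 := by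
    intro x
    rw [← parseval_torus]
    congr 1
    funext y
    rw [re_sq (fourierSum_im m hm f _ _)]
    unfold fourierSum
    rw [Finset.sum_comm]
    congr 2
    refine Finset.sum_congr rfl fun l _ => ?_
    rw [Finset.sum_mul]
    exact Finset.sum_congr rfl fun k _ => by ring
  simp only [h1]
  rw [intervalIntegral.integral_finsetSum, Finset.sum_comm]
  · exact Finset.sum_congr rfl fun l _ => parseval_torus _
  · intro l _
    apply Continuous.intervalIntegrable
    have := continuous_mode
    fun_prop

/-- The interpolant takes the grid values at the nodes. -/
lemma interp_node {N : ℕ} (f : Grid N) (i j : Fin (2 * N + 1)) :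
    interp f (node N i) (node N j) = f i j := by
  have dual : ∀ i a : Fin (2 * N + 1),
      (mesh N : ℂ) * ∑ k ∈ freq N, mode (-k) (node N a) * mode k (node N i)
        = if a = i then 1 else 0 := by
    intro i a
    have h1 : ∑ k ∈ freq N, mode (-k) (node N a) * mode k (node N i)
        = mode (-(N : ℤ)) (node N i) * mode N (node N a)
          * ∑ b : Fin (2 * N + 1), mode ((i : ℤ) - a) (node N b) := by
      have hb : ∑ b : Fin (2 * N + 1), mode ((i : ℤ) - a) (node N b)
          = ∑ b ∈ Finset.range (2 * N + 1), mode ((i : ℤ) - a) ((b : ℕ) * mesh N) :=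
        Fin.sum_univ_eq_sum_range (fun b => mode ((i : ℤ) - a) ((b : ℕ) * mesh N)) _
      rw [hb, Finset.mul_sum]
      refine Finset.sum_nbij' (fun k => (k + N).toNat) (fun b => (b : ℤ) - N) ?_ ?_ ?_ ?_ ?_
      · intro k hk
        simp only [freq, Finset.mem_Icc] at hk
        simp only [Finset.mem_range]
        omega
      · intro k hk
        simp only [Finset.mem_range] at hk
        simp only [freq, Finset.mem_Icc]
        omega
      · intro k hk
        simp only [freq, Finset.mem_Icc] at hk
        omega
      · intro k hk
        omega
      · intro k hk
        simp only [freq, Finset.mem_Icc] at hk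
        have : (((k + N).toNat : ℕ) : ℂ) = k + N := by
          have : (((k + N).toNat : ℕ) : ℤ) = k + N := by omega
          exact_mod_cast this
        unfold mode node
        rw [← exp_add, ← exp_add, ← exp_add]
        congr 1
        push_cast
        rw [this]
        ring
    rw [h1, mul_left_comm, sum_mode _ (by rw [abs_le]; omega)]
    by_cases h : a = i
    · subst h
      simp [mode_add]
      simp [mode]
    · rw [if_neg (by omega), if_neg h, mul_zero]
  have : fourierSum (fun _ _ => 1) f (node N i) (node N j) = f i j := by
    have h2 : fourierSum (fun _ _ => 1) f (node N i) (node N j)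
        = ∑ a, ∑ b, (f a b : ℂ)
          * (((mesh N : ℂ) * ∑ k ∈ freq N, mode (-k) (node N a) * mode k (node N i))
          * ((mesh N : ℂ) * ∑ l ∈ freq N, mode (-l) (node N b) * mode l (node N j))) := by
      have swap : ∀ F : ℤ → ℤ → Fin (2 * N + 1) → Fin (2 * N + 1) → ℂ,
          ∑ k ∈ freq N, ∑ l ∈ freq N, ∑ a, ∑ b, F k l a b
            = ∑ a, ∑ b, ∑ k ∈ freq N, ∑ l ∈ freq N, F k l a b := by
        intro F
        calc _ = ∑ k ∈ freq N, ∑ a, ∑ l ∈ freq N, ∑ b, F k l a b :=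
              Finset.sum_congr rfl fun k _ => Finset.sum_comm
          _ = ∑ k ∈ freq N, ∑ a, ∑ b, ∑ l ∈ freq N, F k l a b :=
              Finset.sum_congr rfl fun k _ => Finset.sum_congr rfl fun a _ => Finset.sum_comm
          _ = ∑ a, ∑ k ∈ freq N, ∑ b, ∑ l ∈ freq N, F k l a b := Finset.sum_comm
          _ = _ := Finset.sum_congr rfl fun a _ => Finset.sum_comm
      unfold fourierSum coeff
      simp only [one_mul, Finset.mul_sum, Finset.sum_mul]
      rw [swap]
      refine Finset.sum_congr rfl fun a _ => Finset.sum_congr rfl fun b _ => ?_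
      rw [Finset.sum_comm]
      refine Finset.sum_congr rfl fun k _ => Finset.sum_congr rfl fun l _ => ?_
      ring
    rw [h2]
    simp only [dual]
    simp
  rw [interp, this, ofReal_re]

lemma hasDerivAt_mode (k : ℤ) (x : ℝ) :
    HasDerivAt (mode k) (2 * Real.pi * I * k * mode k x) x := by
  have h : HasDerivAt (fun x : ℝ => (2 * Real.pi * I * k * x : ℂ)) (2 * Real.pi * I * k) x := by
    simpa using (ofRealCLM.hasDerivAt (x := x)).const_mul (2 * Real.pi * I * k : ℂ)
  exact h.cexp.congr_deriv (mul_comm _ _)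

lemma deriv_fourier_x {N : ℕ} (m : ℤ → ℤ → ℂ) (f : Grid N) (x y : ℝ) :
    deriv (fun s => (fourierSum m f s y).re) x
      = (fourierSum (fun k l => 2 * Real.pi * I * k * m k l) f x y).re := by
  have h : HasDerivAt (fun s => fourierSum m f s y)
      (fourierSum (fun k l => 2 * Real.pi * I * k * m k l) f x y) x := by
    unfold fourierSum
    refine HasDerivAt.fun_sum fun k _ => HasDerivAt.fun_sum fun l _ => ?_
    have := ((hasDerivAt_mode k x).mul_const (mode l y)).const_mul (m k l * coeff f k l)
    refine this.congr_deriv ?_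
    ring
  exact (reCLM.hasFDerivAt.comp_hasDerivAt x h).deriv

lemma deriv_fourier_y {N : ℕ} (m : ℤ → ℤ → ℂ) (f : Grid N) (x y : ℝ) :
    deriv (fun s => (fourierSum m f x s).re) y
      = (fourierSum (fun k l => 2 * Real.pi * I * l * m k l) f x y).re := by
  have h : HasDerivAt (fun s => fourierSum m f x s)
      (fourierSum (fun k l => 2 * Real.pi * I * l * m k l) f x y) y := by
    unfold fourierSum
    refine HasDerivAt.fun_sum fun k _ => HasDerivAt.fun_sum fun l _ => ?_
    have := ((hasDerivAt_mode l y).const_mul (mode k x)).const_mul (m k l * coeff f k l)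
    refine this.congr_deriv ?_
    ring
  exact (reCLM.hasFDerivAt.comp_hasDerivAt y h).deriv

/-- The discrete `L²` norm of a grid function is the `L²` norm of its interpolant. -/
theorem normL2_eq {N : ℕ} (f : Grid N) : normL2 f = interpL2 f := by
  have h := sum_grid_fourier (fun _ _ => 1) (by simp) f
  have hf : (fun i j => (fourierSum (fun _ _ => 1) f (node N i) (node N j)).re) = f :=
    funext fun i => funext fun j => interp_node f i j
  rw [hf] at h
  unfold normL2 interpL2 interp
  rw [h, integral_fourier _ (by simp)]

/-- The discrete `H¹` norm of a grid function is the `H¹` norm of its interpolant. -/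
theorem normH1_eq {N : ℕ} (f : Grid N) : normH1 f = interpH1 f := by
  unfold normH1 interpH1 interp
  simp only [deriv_fourier_x, deriv_fourier_y, mul_one]
  rw [integral_fourier _ (by simp [map_ofNat]), integral_fourier _ (by simp [map_ofNat])]
  unfold Dx Dy
  rw [sum_grid_fourier _ (by simp [map_ofNat]), sum_grid_fourier _ (by simp [map_ofNat])]

/-- The discrete `H²` norm of a grid function is the `H²` norm of its interpolant. -/
theorem normH2_eq {N : ℕ} (f : Grid N) : normH2 f = interpH2 f := by
  have hadd : ∀ x y : ℝ,
      (fourierSum (fun k _ => -(4 * Real.pi ^ 2 * (k : ℂ) ^ 2)) f x y).re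
        + (fourierSum (fun _ l => -(4 * Real.pi ^ 2 * (l : ℂ) ^ 2)) f x y).re
      = (fourierSum (fun k l => -(4 * Real.pi ^ 2 * ((k : ℂ) ^ 2 + (l : ℂ) ^ 2))) f x y).re := by
    intro x y
    rw [← add_re]
    unfold fourierSum
    simp only [← Finset.sum_add_distrib]
    congr 1
    refine Finset.sum_congr rfl fun k _ => Finset.sum_congr rfl fun l _ => ?_
    ring
  have hI : ∀ k : ℂ, 2 * Real.pi * I * k * (2 * Real.pi * I * k)
      = -(4 * Real.pi ^ 2 * k ^ 2) := by
    intro k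
    linear_combination (4 * Real.pi ^ 2 * k ^ 2) * I_sq
  have hx : ∀ (m : ℤ → ℤ → ℂ) (y : ℝ), deriv (fun s => (fourierSum m f s y).re)
      = fun x => (fourierSum (fun k l => 2 * Real.pi * I * k * m k l) f x y).re :=
    fun m y => funext fun x => deriv_fourier_x m f x y
  have hy : ∀ (m : ℤ → ℤ → ℂ) (x : ℝ), deriv (fun s => (fourierSum m f x s).re)
      = fun y => (fourierSum (fun k l => 2 * Real.pi * I * l * m k l) f x y).re :=
    fun m x => funext fun y => deriv_fourier_y m f x y
  unfold normH2 normL2 interpH2 interp lap Dxx Dyy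
  simp only [hx, hy, mul_one, hI, hadd]
  rw [integral_fourier _ (by simp [map_ofNat]), sum_grid_fourier _ (by simp [map_ofNat])]

end

end CollocNS

/-!
Everything takes place in the discrete Fourier coefficients. A grid function is determined by its
coefficients (`grid_ext`), the collocation derivatives are multipliers (`hat_Dx`, `hat_Dy`,
`hat_lap`), the discrete Parseval identity (`inner2_eq`) gives summation by parts and the Poincaré
inequalities, and the coefficients of a pointwise product are the convolution of the coefficients,
taken over the frequencies modulo `2N+1` (`hat_mul`).

*The nonlinear term.* Its form `½ (𝒖·∇w + ∇·(𝒖 w))` is skew-adjoint on the grid in spite of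
aliasing (`inner2_adv`). A resolved frequency is the smallest one in its class modulo `2N+1`, so
aliasing never increases the weight of a derivative, and the `k`-th coefficient is at most the sum of
`(1 + 2|q|/|p|) |ω̂_p| |ŵ_q|` over `p + q ≡ k` (`norm_hat_adv_le`). The Cauchy-Schwarz inequality with
suitable weights, and the convergence of `∑ |k|⁻³` over the nonzero points of `ℤ²`, bound the `L²` norm
of this term uniformly in `N`: by `‖ω‖_{H¹} ‖w‖_{H¹}` (`inner2_adv_le_H1`), and by `‖ω‖₂` times
the `H^{3/2}` norm of `w`, which is interpolated between `L²` and `H²` (`inner2_adv_le_H2`).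

*One time step.* Testing the scheme with `ω^{n+1}`, skew-adjointness leaves only the pairing of the
increment `ω^{n+1} - ω^n` with the advection of `ω^{n+1}`. The first bound and the restriction
on the time step absorb it into the numerical dissipation and the viscosity (`energy_L2`). Testing
with `Δ ω^{n+1}`, the advected `ω^n` is replaced by `ω^{n+1}` up to the increment, which is treated in
the same way, while the second bound leaves a source proportional to the fifth power of a bound `X`
for the squared `L²` norm (`energy_H1`).

*Induction.* The `L²` estimate makes `X` a constant depending on `ν` and `F`, plus a transient of
size `θⁿ`, and by convexity the source in the `H¹` inequality has the same shape. That inequality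
damps at twice the rate behind `θ`, so the transient source only contributes
`θⁿ A (1 - θⁿ)` (`gronwall_step_transient`). The resulting bound in `H¹` is what the
restriction on the time step needs at the next level (`IsSolution.decay_estimates`). The summed
bounds follow by telescoping (`sum_le_of_step`).
-/

namespace CollocNS

open Complex Finset

/-! ### Fourier coefficients on the grid -/

/-- The coefficient of frequency `k = (k₁, k₂)`. -/
noncomputable def hat {N : ℕ} (f : Grid N) (k : ℤ × ℤ) : ℂ := coeff f k.1 k.2

/-- The square of resolved frequencies. -/
noncomputable def freq2 (N : ℕ) : Finset (ℤ × ℤ) := freq N ×ˢ freq N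

/-- Two frequencies are congruent if their modes agree at all nodes of the grid. -/
def Alias (N : ℕ) (p k : ℤ × ℤ) : Prop :=
  ((2 * N + 1 : ℤ) ∣ p.1 - k.1) ∧ ((2 * N + 1 : ℤ) ∣ p.2 - k.2)

instance (N : ℕ) (p k : ℤ × ℤ) : Decidable (Alias N p k) := by
  unfold Alias; infer_instance

lemma mem_freq2 {N : ℕ} {k : ℤ × ℤ} : k ∈ freq2 N ↔ |k.1| ≤ N ∧ |k.2| ≤ N := by
  simp [freq2, freq, abs_le]

lemma int_eq_of_dvd_sub {N : ℕ} {a b : ℤ} (ha : |a| ≤ N) (hb : |b| ≤ N)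
    (h : (2 * N + 1 : ℤ) ∣ a - b) : a = b := by
  rw [abs_le] at ha hb
  have := Int.eq_zero_of_abs_lt_dvd h (by rw [abs_lt]; omega)
  omega

lemma Alias.eq {N : ℕ} {p k : ℤ × ℤ} (hp : p ∈ freq2 N) (hk : k ∈ freq2 N)
    (h : Alias N p k) : p = k := by
  rw [mem_freq2] at hp hk
  exact Prod.ext (int_eq_of_dvd_sub hp.1 hk.1 h.1) (int_eq_of_dvd_sub hp.2 hk.2 h.2)

lemma alias_iff {N : ℕ} {p k : ℤ × ℤ} (hp : p ∈ freq2 N) (hk : k ∈ freq2 N) :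
    Alias N p k ↔ p = k := by
  refine ⟨fun h => h.eq hp hk, ?_⟩
  rintro rfl
  simp [Alias]

lemma sum_mode_dvd {N : ℕ} (k : ℤ) :
    (mesh N : ℂ) * ∑ i, mode k (node N i) = if (2 * N + 1 : ℤ) ∣ k then 1 else 0 := by
  -- `sum_mode` covers the residue of `k` modulo `2N+1`, whose mode agrees with that of `k` on the grid
  have hper : ∀ i, mode k (node N i) = mode (k % (2 * N + 1)) (node N i) := by
    intro i
    have hk : k = k % (2 * N + 1) + (2 * N + 1) * (k / (2 * N + 1)) :=
      (Int.emod_add_mul_ediv k (2 * N + 1)).symm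
    set r := k % (2 * N + 1)
    set t := k / (2 * N + 1)
    rw [hk, ← mode_add]
    have : mode ((2 * N + 1) * t) (node N i) = 1 := by
      unfold mode
      rw [exp_eq_one_iff]
      refine ⟨t * i, ?_⟩
      unfold node
      push_cast
      linear_combination (2 * Real.pi * I * t * i) * mesh_mul N
    rw [this, mul_one]
  simp only [hper]
  have h0 := Int.emod_nonneg k (by omega : (2 * N + 1 : ℤ) ≠ 0)
  have h1 := Int.emod_lt_of_pos k (by omega : (0 : ℤ) < 2 * N + 1)
  rw [sum_mode _ (by rw [abs_le]; omega)]
  simp only [Int.dvd_iff_emod_eq_zero]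

/-- Aliasing: sampling a trigonometric polynomial on the grid adds up the coefficients of
congruent frequencies. -/
lemma hat_of_sum {N : ℕ} {ι : Type*} (T : Finset ι) (a : ι → ℂ) (s : ι → ℤ × ℤ) (f : Grid N)
    (hf : ∀ i j, (f i j : ℂ)
      = ∑ t ∈ T, a t * (mode (s t).1 (node N i) * mode (s t).2 (node N j))) (k : ℤ × ℤ) :
    hat f k = ∑ t ∈ T, if Alias N (s t) k then a t else 0 := by
  have h : ∀ t, (if Alias N (s t) k then a t else 0)
      = a t * (((mesh N : ℂ) * ∑ i, mode ((s t).1 - k.1) (node N i))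
        * ((mesh N : ℂ) * ∑ j, mode ((s t).2 - k.2) (node N j))) := by
    intro t
    rw [sum_mode_dvd, sum_mode_dvd]
    by_cases h1 : (2 * N + 1 : ℤ) ∣ (s t).1 - k.1 <;>
      by_cases h2 : (2 * N + 1 : ℤ) ∣ (s t).2 - k.2 <;> simp [Alias, h1, h2]
  simp only [h, hat, coeff, hf, Finset.sum_mul, Finset.mul_sum]
  calc _ = ∑ i, ∑ t ∈ T, ∑ j, (mesh N : ℂ) ^ 2 *
        (a t * (mode (s t).1 (node N i) * mode (s t).2 (node N j))
          * (mode (-k.1) (node N i) * mode (-k.2) (node N j))) :=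
        Finset.sum_congr rfl fun i _ => Finset.sum_comm
    _ = _ := by
      rw [Finset.sum_comm]
      refine Finset.sum_congr rfl fun t _ => ?_
      rw [Finset.sum_comm]
      refine Finset.sum_congr rfl fun j _ => Finset.sum_congr rfl fun i _ => ?_
      rw [sub_eq_add_neg, sub_eq_add_neg, ← mode_add, ← mode_add]
      ring

/-- The Fourier multiplier with symbol `m`, as an operator on grid functions. -/
noncomputable def mulOp {N : ℕ} (m : ℤ × ℤ → ℂ) (f : Grid N) : Grid N := fun i j =>
  (fourierSum (fun k l => m (k, l)) f (node N i) (node N j)).re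

/-- Symbols of multipliers that map real grid functions to real grid functions. -/
def Hermitian (m : ℤ × ℤ → ℂ) : Prop := ∀ k, (starRingEnd ℂ) (m k) = m (-k)

lemma mulOp_coe {N : ℕ} {m : ℤ × ℤ → ℂ} (hm : Hermitian m) (f : Grid N) (i j : Fin (2 * N + 1)) :
    (mulOp m f i j : ℂ)
      = ∑ k ∈ freq2 N, m k * hat f k * (mode k.1 (node N i) * mode k.2 (node N j)) := by
  have h : (mulOp m f i j : ℂ) = fourierSum (fun k l => m (k, l)) f (node N i) (node N j) := by
    refine Complex.ext ?_ ?_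
    · simp [mulOp]
    · rw [fourierSum_im _ (fun k l => hm (k, l))]
      simp
  rw [h, fourierSum, freq2, Finset.sum_product]
  rfl

lemma hat_mulOp {N : ℕ} {m : ℤ × ℤ → ℂ} (hm : Hermitian m) (f : Grid N) {k : ℤ × ℤ}
    (hk : k ∈ freq2 N) : hat (mulOp m f) k = m k * hat f k := by
  rw [hat_of_sum (freq2 N) (fun k => m k * hat f k) id (mulOp m f) (mulOp_coe hm f)]
  rw [Finset.sum_congr rfl fun t ht => by rw [id, if_congr (alias_iff ht hk) rfl rfl]]
  rw [Finset.sum_ite_eq' (freq2 N) k, if_pos hk]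

lemma hermitian_one : Hermitian (fun _ => 1) := fun _ => map_one _

lemma mulOp_one {N : ℕ} (f : Grid N) : mulOp (fun _ => 1) f = f :=
  funext fun i => funext fun j => interp_node f i j

/-- Fourier inversion on the grid. -/
lemma coe_eq_sum_hat {N : ℕ} (f : Grid N) (i j : Fin (2 * N + 1)) :
    (f i j : ℂ) = ∑ k ∈ freq2 N, hat f k * (mode k.1 (node N i) * mode k.2 (node N j)) := by
  have := mulOp_coe hermitian_one f i j
  simpa only [mulOp_one, one_mul] using this

/-- The coefficients of a product on the grid are the aliased convolution of the coefficients. -/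
lemma hat_mul {N : ℕ} (f g : Grid N) (k : ℤ × ℤ) :
    hat (fun i j => f i j * g i j) k
      = ∑ t ∈ freq2 N ×ˢ freq2 N, if Alias N (t.1 + t.2) k then hat f t.1 * hat g t.2 else 0 := by
  refine hat_of_sum _ (fun t : (ℤ × ℤ) × (ℤ × ℤ) => hat f t.1 * hat g t.2)
    (fun t => t.1 + t.2) _ (fun i j => ?_) k
  push_cast
  rw [coe_eq_sum_hat f, coe_eq_sum_hat g, Finset.sum_mul_sum, Finset.sum_product]
  refine Finset.sum_congr rfl fun p _ => Finset.sum_congr rfl fun q _ => ?_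
  simp only [Prod.fst_add, Prod.snd_add, ← mode_add]
  ring

lemma hat_add {N : ℕ} (f g : Grid N) (k : ℤ × ℤ) : hat (f + g) k = hat f k + hat g k := by
  simp only [hat, coeff, Pi.add_apply, ofReal_add, add_mul, Finset.sum_add_distrib, mul_add]

lemma hat_smul {N : ℕ} (c : ℝ) (f : Grid N) (k : ℤ × ℤ) : hat (c • f) k = c * hat f k := by
  simp only [hat, coeff, Pi.smul_apply, smul_eq_mul, ofReal_mul, mul_assoc, ← Finset.mul_sum]
  ring

lemma hat_neg {N : ℕ} (f : Grid N) (k : ℤ × ℤ) : hat (-f) k = -hat f k := by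
  have := hat_smul (-1) f k
  simpa using this

lemma hat_sub {N : ℕ} (f g : Grid N) (k : ℤ × ℤ) : hat (f - g) k = hat f k - hat g k := by
  rw [sub_eq_add_neg, hat_add, hat_neg, sub_eq_add_neg]

/-- A grid function is determined by its resolved coefficients. -/
lemma grid_ext {N : ℕ} {f g : Grid N} (h : ∀ k ∈ freq2 N, hat f k = hat g k) : f = g := by
  funext i j
  apply ofReal_injective
  rw [coe_eq_sum_hat f, coe_eq_sum_hat g]
  exact Finset.sum_congr rfl fun k hk => by rw [h k hk]

/-- The discrete Parseval identity. -/
lemma inner2_eq {N : ℕ} (f g : Grid N) :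
    (inner2 f g : ℂ) = ∑ k ∈ freq2 N, hat f k * (starRingEnd ℂ) (hat g k) := by
  unfold inner2
  push_cast
  simp only [coe_eq_sum_hat f, hat, conj_coeff, Finset.sum_mul]
  rw [Finset.sum_congr rfl fun i _ => Finset.sum_comm, Finset.sum_comm, Finset.mul_sum]
  refine Finset.sum_congr rfl fun k _ => ?_
  simp only [coeff, neg_neg, Finset.mul_sum]
  refine Finset.sum_congr rfl fun i _ => Finset.sum_congr rfl fun j _ => ?_
  ring

lemma inner2_self {N : ℕ} (f : Grid N) : inner2 f f = ∑ k ∈ freq2 N, ‖hat f k‖ ^ 2 := by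
  apply ofReal_injective
  rw [inner2_eq]
  push_cast
  exact Finset.sum_congr rfl fun k _ => mul_conj' _

lemma inner2_comm {N : ℕ} (f g : Grid N) : inner2 f g = inner2 g f := by
  simp only [inner2, mul_comm]

lemma inner2_add_left {N : ℕ} (f g r : Grid N) : inner2 (f + g) r = inner2 f r + inner2 g r := by
  simp only [inner2, Pi.add_apply, add_mul, Finset.sum_add_distrib, mul_add]

lemma inner2_smul_left {N : ℕ} (c : ℝ) (f r : Grid N) : inner2 (c • f) r = c * inner2 f r := by
  simp only [inner2, Pi.smul_apply, smul_eq_mul, mul_assoc, ← Finset.mul_sum]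
  ring

lemma inner2_sub_left {N : ℕ} (f g r : Grid N) : inner2 (f - g) r = inner2 f r - inner2 g r := by
  simp only [inner2, Pi.sub_apply, sub_mul, Finset.sum_sub_distrib, mul_sub]

lemma inner2_neg_left {N : ℕ} (f r : Grid N) : inner2 (-f) r = -inner2 f r := by
  simp only [inner2, Pi.neg_apply, neg_mul, Finset.sum_neg_distrib, mul_neg]

lemma inner2_add_right {N : ℕ} (f g r : Grid N) : inner2 r (f + g) = inner2 r f + inner2 r g := by
  simp only [inner2_comm r, inner2_add_left]

lemma inner2_sub_right {N : ℕ} (f g r : Grid N) : inner2 r (f - g) = inner2 r f - inner2 r g := by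
  simp only [inner2_comm r, inner2_sub_left]

lemma inner2_neg_right {N : ℕ} (f r : Grid N) : inner2 r (-f) = -inner2 r f := by
  simp only [inner2_comm r, inner2_neg_left]

lemma inner2_self_nonneg {N : ℕ} (f : Grid N) : 0 ≤ inner2 f f := by
  rw [inner2_self]; positivity

lemma normL2_sq {N : ℕ} (f : Grid N) : normL2 f ^ 2 = inner2 f f :=
  Real.sq_sqrt (inner2_self_nonneg f)

/-- Weighted form of the Cauchy-Schwarz inequality for the discrete inner product. -/
lemma two_mul_inner2_le {N : ℕ} (f g : Grid N) {e : ℝ} (he : 0 < e) :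
    2 * inner2 f g ≤ e * inner2 f f + e⁻¹ * inner2 g g := by
  have h := inner2_self_nonneg (e • f - g)
  simp only [inner2_sub_left, inner2_sub_right, inner2_smul_left, inner2_comm _ (e • f)] at h
  have h2 : 0 ≤ e⁻¹ * (e * (e * inner2 f f) - e * inner2 f g - (e * inner2 f g - inner2 g g)) :=
    mul_nonneg (by positivity) (by linarith)
  have h3 : e⁻¹ * (e * (e * inner2 f f) - e * inner2 f g - (e * inner2 f g - inner2 g g))
      = e * inner2 f f + e⁻¹ * inner2 g g - 2 * inner2 f g := by
    field_simp
    ring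
  linarith

/-! ### The collocation derivatives as Fourier multipliers -/

lemma hat_Dx {N : ℕ} (f : Grid N) {k : ℤ × ℤ} (hk : k ∈ freq2 N) :
    hat (Dx f) k = 2 * Real.pi * I * k.1 * hat f k :=
  hat_mulOp (m := fun k => 2 * Real.pi * I * k.1) (fun k => by simp [map_ofNat]) f hk

lemma hat_Dy {N : ℕ} (f : Grid N) {k : ℤ × ℤ} (hk : k ∈ freq2 N) :
    hat (Dy f) k = 2 * Real.pi * I * k.2 * hat f k :=
  hat_mulOp (m := fun k => 2 * Real.pi * I * k.2) (fun k => by simp [map_ofNat]) f hk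

lemma hat_lap {N : ℕ} (f : Grid N) {k : ℤ × ℤ} (hk : k ∈ freq2 N) :
    hat (lap f) k = -(4 * Real.pi ^ 2 * ((k.1 : ℂ) ^ 2 + (k.2 : ℂ) ^ 2)) * hat f k := by
  have hx : hat (Dxx f) k = -(4 * Real.pi ^ 2 * (k.1 : ℂ) ^ 2) * hat f k :=
    hat_mulOp (m := fun k => -(4 * Real.pi ^ 2 * (k.1 : ℂ) ^ 2))
      (fun k => by simp [map_ofNat]) f hk
  have hy : hat (Dyy f) k = -(4 * Real.pi ^ 2 * (k.2 : ℂ) ^ 2) * hat f k :=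
    hat_mulOp (m := fun k => -(4 * Real.pi ^ 2 * (k.2 : ℂ) ^ 2))
      (fun k => by simp [map_ofNat]) f hk
  have : lap f = Dxx f + Dyy f := rfl
  rw [this, hat_add, hx, hy]
  ring

lemma lap_eq {N : ℕ} (f : Grid N) : lap f = Dx (Dx f) + Dy (Dy f) := by
  refine grid_ext fun k hk => ?_
  rw [hat_lap f hk, hat_add, hat_Dx _ hk, hat_Dx _ hk, hat_Dy _ hk, hat_Dy _ hk]
  linear_combination (-4 * Real.pi ^ 2 * ((k.1 : ℂ) ^ 2 + (k.2 : ℂ) ^ 2) * hat f k) * I_sq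

lemma Dx_sub {N : ℕ} (f g : Grid N) : Dx (f - g) = Dx f - Dx g := by
  refine grid_ext fun k hk => ?_
  rw [hat_sub, hat_Dx _ hk, hat_Dx _ hk, hat_Dx _ hk, hat_sub]
  ring

lemma Dy_sub {N : ℕ} (f g : Grid N) : Dy (f - g) = Dy f - Dy g := by
  refine grid_ext fun k hk => ?_
  rw [hat_sub, hat_Dy _ hk, hat_Dy _ hk, hat_Dy _ hk, hat_sub]
  ring

/-- Summation by parts in `x`. -/
lemma inner2_Dx {N : ℕ} (f g : Grid N) : inner2 (Dx f) g = -inner2 f (Dx g) := by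
  apply ofReal_injective
  rw [ofReal_neg, inner2_eq, inner2_eq, ← Finset.sum_neg_distrib]
  refine Finset.sum_congr rfl fun k hk => ?_
  rw [hat_Dx _ hk, hat_Dx _ hk]
  simp [map_ofNat]
  ring

/-- Summation by parts in `y`. -/
lemma inner2_Dy {N : ℕ} (f g : Grid N) : inner2 (Dy f) g = -inner2 f (Dy g) := by
  apply ofReal_injective
  rw [ofReal_neg, inner2_eq, inner2_eq, ← Finset.sum_neg_distrib]
  refine Finset.sum_congr rfl fun k hk => ?_
  rw [hat_Dy _ hk, hat_Dy _ hk]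
  simp [map_ofNat]
  ring

/-- The discrete `H¹` inner product. -/
noncomputable def innerH1 {N : ℕ} (f g : Grid N) : ℝ :=
  inner2 (Dx f) (Dx g) + inner2 (Dy f) (Dy g)

lemma inner2_lap {N : ℕ} (f g : Grid N) : inner2 f (lap g) = -innerH1 f g := by
  rw [lap_eq, inner2_add_right, innerH1, inner2_Dx f, inner2_Dy f]
  ring

lemma innerH1_self_nonneg {N : ℕ} (f : Grid N) : 0 ≤ innerH1 f f :=
  add_nonneg (inner2_self_nonneg _) (inner2_self_nonneg _)

lemma normH1_sq {N : ℕ} (f : Grid N) : normH1 f ^ 2 = innerH1 f f :=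
  Real.sq_sqrt (innerH1_self_nonneg f)

lemma innerH1_sub_self {N : ℕ} (f g : Grid N) :
    innerH1 (f - g) (f - g) = innerH1 g g - innerH1 f f + 2 * innerH1 (f - g) f := by
  simp only [innerH1, Dx_sub, Dy_sub, inner2_sub_left, inner2_sub_right]
  rw [inner2_comm (Dx g) (Dx f), inner2_comm (Dy g) (Dy f)]
  ring

lemma inner2_sub_self {N : ℕ} (f g : Grid N) :
    inner2 (f - g) (f - g) = inner2 g g - inner2 f f + 2 * inner2 (f - g) f := by
  simp only [inner2_sub_left, inner2_sub_right]
  rw [inner2_comm g f]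
  ring

lemma innerH1_self {N : ℕ} (f : Grid N) :
    innerH1 f f = ∑ k ∈ freq2 N,
      4 * Real.pi ^ 2 * ((k.1 : ℝ) ^ 2 + (k.2 : ℝ) ^ 2) * ‖hat f k‖ ^ 2 := by
  rw [innerH1, inner2_self, inner2_self, ← Finset.sum_add_distrib]
  refine Finset.sum_congr rfl fun k hk => ?_
  rw [hat_Dx _ hk, hat_Dy _ hk]
  simp only [norm_mul, mul_pow, norm_ofNat, norm_real, norm_I, norm_intCast, Real.norm_eq_abs,
    sq_abs]
  ring

lemma inner2_lap_self {N : ℕ} (f : Grid N) :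
    inner2 (lap f) (lap f) = ∑ k ∈ freq2 N,
      (4 * Real.pi ^ 2 * ((k.1 : ℝ) ^ 2 + (k.2 : ℝ) ^ 2)) ^ 2 * ‖hat f k‖ ^ 2 := by
  rw [inner2_self]
  refine Finset.sum_congr rfl fun k hk => ?_
  have h : -(4 * Real.pi ^ 2 * ((k.1 : ℂ) ^ 2 + (k.2 : ℂ) ^ 2))
      = ((-(4 * Real.pi ^ 2 * ((k.1 : ℝ) ^ 2 + (k.2 : ℝ) ^ 2)) : ℝ) : ℂ) := by
    push_cast; ring
  rw [hat_lap _ hk, h, norm_mul, mul_pow, norm_real, Real.norm_eq_abs, sq_abs]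
  ring

/-! ### The Poincaré inequality -/

lemma one_le_sq_add_sq {k : ℤ × ℤ} (hk : k ≠ 0) : (1 : ℝ) ≤ (k.1 : ℝ) ^ 2 + (k.2 : ℝ) ^ 2 := by
  have : (1 : ℤ) ≤ k.1 ^ 2 + k.2 ^ 2 := by
    by_contra! h
    have h1 : k.1 = 0 := by nlinarith [sq_nonneg k.1, sq_nonneg k.2]
    have h2 : k.2 = 0 := by nlinarith [sq_nonneg k.1, sq_nonneg k.2]
    exact hk (Prod.ext h1 h2)
  exact_mod_cast this

/-- The Poincaré inequality. -/
lemma inner2_le_innerH1 {N : ℕ} {f : Grid N} (h0 : hat f 0 = 0) :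
    inner2 f f ≤ c0 ^ 2 * innerH1 f f := by
  rw [inner2_self, innerH1_self, Finset.mul_sum]
  refine Finset.sum_le_sum fun k _ => ?_
  by_cases hk : k = 0
  · simp [hk, h0]
  · have h1 := one_le_sq_add_sq hk
    have h2 : c0 ^ 2 * (4 * Real.pi ^ 2 * ((k.1 : ℝ) ^ 2 + (k.2 : ℝ) ^ 2) * ‖hat f k‖ ^ 2)
        = ((k.1 : ℝ) ^ 2 + (k.2 : ℝ) ^ 2) * ‖hat f k‖ ^ 2 := by
      have := Real.pi_ne_zero
      unfold c0
      field_simp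
      ring
    rw [h2]
    nlinarith [sq_nonneg ‖hat f k‖]

/-- The Poincaré inequality for the gradient. -/
lemma innerH1_le_lap {N : ℕ} (f : Grid N) :
    innerH1 f f ≤ c0 ^ 2 * inner2 (lap f) (lap f) := by
  rw [inner2_lap_self, innerH1_self, Finset.mul_sum]
  refine Finset.sum_le_sum fun k _ => ?_
  by_cases hk : k = 0
  · simp [hk]
  · have h1 := one_le_sq_add_sq hk
    set s := (k.1 : ℝ) ^ 2 + (k.2 : ℝ) ^ 2
    have h2 : c0 ^ 2 * ((4 * Real.pi ^ 2 * s) ^ 2 * ‖hat f k‖ ^ 2)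
        = s * (4 * Real.pi ^ 2 * s * ‖hat f k‖ ^ 2) := by
      have := Real.pi_ne_zero
      unfold c0
      field_simp
      ring
    rw [h2]
    have : 0 ≤ 4 * Real.pi ^ 2 * s * ‖hat f k‖ ^ 2 := by positivity
    nlinarith

/-! ### The nonlinear term -/

/-- The skew-symmetric form `½ (𝒖·∇w + ∇·(𝒖 w))` of the advection of `w` by `𝒖 = (u, v)`. -/
noncomputable def adv {N : ℕ} (u v w : Grid N) : Grid N := fun i j =>
  1 / 2 * ((u i j * Dx w i j + v i j * Dy w i j)
    + (Dx (fun a b => u a b * w a b) i j + Dy (fun a b => v a b * w a b) i j))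

lemma adv_eq {N : ℕ} (u v w : Grid N) :
    adv u v w = (1 / 2 : ℝ) • ((u * Dx w + v * Dy w) + (Dx (u * w) + Dy (v * w))) := rfl

lemma inner2_mul_left {N : ℕ} (u f g : Grid N) : inner2 (u * f) g = inner2 f (u * g) := by
  simp only [inner2, Pi.mul_apply]
  congr 1
  exact Finset.sum_congr rfl fun i _ => Finset.sum_congr rfl fun j _ => by ring

/-- Advection is skew-adjoint, whatever the velocity field. -/
lemma inner2_adv {N : ℕ} (u v f g : Grid N) : inner2 (adv u v f) g = -inner2 f (adv u v g) := by
  have ex : ∀ a b : Grid N, inner2 a (Dx (u * b)) = -inner2 b (u * Dx a) := fun a b => by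
    rw [inner2_comm b, inner2_mul_left, inner2_Dx, neg_neg]
  have ey : ∀ a b : Grid N, inner2 a (Dy (v * b)) = -inner2 b (v * Dy a) := fun a b => by
    rw [inner2_comm b, inner2_mul_left, inner2_Dy, neg_neg]
  rw [inner2_comm (adv u v f), adv_eq, adv_eq]
  simp only [inner2_comm _ ((1 / 2 : ℝ) • _), inner2_smul_left]
  simp only [inner2_comm _ f, inner2_comm _ g, inner2_add_right, ex, ey]
  ring

lemma inner2_adv_self {N : ℕ} (u v f : Grid N) : inner2 (adv u v f) f = 0 := by
  have := inner2_adv u v f f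
  rw [inner2_comm f] at this
  linarith

lemma adv_sub {N : ℕ} (u v f g : Grid N) : adv u v (f - g) = adv u v f - adv u v g := by
  simp only [adv_eq, Dx_sub, Dy_sub, mul_sub, ← smul_sub]
  congr 1
  abel

/-- A resolved frequency is the smallest one in its congruence class. -/
lemma abs_le_of_dvd_sub {N : ℕ} {s k : ℤ} (hk : |k| ≤ N) (h : (2 * N + 1 : ℤ) ∣ s - k) :
    |k| ≤ |s| := by
  by_cases h0 : s - k = 0
  · rw [sub_eq_zero.1 h0]
  · have h1 := Int.le_of_dvd (abs_pos.2 h0) ((dvd_abs _ _).2 h)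
    have h2 := abs_sub s k
    omega

lemma abs_fst_le_norm (k : ℤ × ℤ) : |(k.1 : ℝ)| ≤ ‖k‖ := by
  have := norm_fst_le k
  rwa [Int.norm_eq_abs] at this

lemma abs_snd_le_norm (k : ℤ × ℤ) : |(k.2 : ℝ)| ≤ ‖k‖ := by
  have := norm_snd_le k
  rwa [Int.norm_eq_abs] at this

lemma norm_sq_le (k : ℤ × ℤ) : ‖k‖ ^ 2 ≤ (k.1 : ℝ) ^ 2 + (k.2 : ℝ) ^ 2 := by
  rw [Prod.norm_def, Int.norm_eq_abs, Int.norm_eq_abs]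
  rcases max_choice |(k.1 : ℝ)| |(k.2 : ℝ)| with h | h <;> rw [h, sq_abs] <;> nlinarith

lemma one_le_norm {k : ℤ × ℤ} (hk : k ≠ 0) : 1 ≤ ‖k‖ := by
  by_contra! h
  have h1 := (abs_fst_le_norm k).trans_lt h
  have h2 := (abs_snd_le_norm k).trans_lt h
  have h3 : |k.1| < 1 := by exact_mod_cast h1
  have h4 : |k.2| < 1 := by exact_mod_cast h2
  exact hk (Prod.ext (Int.abs_lt_one_iff.1 h3) (Int.abs_lt_one_iff.1 h4))

lemma norm_le_of_alias {N : ℕ} {p q k : ℤ × ℤ} (hk : k ∈ freq2 N) (h : Alias N (p + q) k) :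
    |(k.1 : ℝ)| ≤ ‖p‖ + ‖q‖ ∧ |(k.2 : ℝ)| ≤ ‖p‖ + ‖q‖ := by
  rw [mem_freq2] at hk
  constructor
  · have h1 : |(k.1 : ℝ)| ≤ |((p + q).1 : ℝ)| := by exact_mod_cast abs_le_of_dvd_sub hk.1 h.1
    exact h1.trans ((abs_fst_le_norm _).trans (norm_add_le p q))
  · have h1 : |(k.2 : ℝ)| ≤ |((p + q).2 : ℝ)| := by exact_mod_cast abs_le_of_dvd_sub hk.2 h.2
    exact h1.trans ((abs_snd_le_norm _).trans (norm_add_le p q))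

/-- The Biot-Savart law gains one derivative. -/
lemma norm_hat_velocity_le {N : ℕ} (ψ : Grid N) {p : ℤ × ℤ} (hp : p ∈ freq2 N) :
    2 * Real.pi * ‖p‖ * ‖hat (Dx ψ) p‖ ≤ ‖hat (lap ψ) p‖ ∧
      2 * Real.pi * ‖p‖ * ‖hat (Dy ψ) p‖ ≤ ‖hat (lap ψ) p‖ := by
  have h : ‖hat (lap ψ) p‖ = 4 * Real.pi ^ 2 * ((p.1 : ℝ) ^ 2 + (p.2 : ℝ) ^ 2) * ‖hat ψ p‖ := by
    have h : -(4 * Real.pi ^ 2 * ((p.1 : ℂ) ^ 2 + (p.2 : ℂ) ^ 2))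
        = ((-(4 * Real.pi ^ 2 * ((p.1 : ℝ) ^ 2 + (p.2 : ℝ) ^ 2)) : ℝ) : ℂ) := by
      push_cast; ring
    rw [hat_lap ψ hp, h, norm_mul, norm_real, norm_neg, Real.norm_of_nonneg (by positivity)]
  have h1 := abs_fst_le_norm p
  have h2 := abs_snd_le_norm p
  have h3 := norm_sq_le p
  have h4 := Real.pi_pos
  rw [h, hat_Dx _ hp, hat_Dy _ hp]
  simp only [norm_mul, norm_ofNat, norm_real, norm_I, norm_intCast, Real.norm_eq_abs,
    abs_of_pos h4]
  constructor
  · calc _ = 4 * Real.pi ^ 2 * (‖p‖ * |(p.1 : ℝ)|) * ‖hat ψ p‖ := by ring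
      _ ≤ 4 * Real.pi ^ 2 * ((p.1 : ℝ) ^ 2 + (p.2 : ℝ) ^ 2) * ‖hat ψ p‖ := by
        gcongr
        nlinarith [norm_nonneg p]
  · calc _ = 4 * Real.pi ^ 2 * (‖p‖ * |(p.2 : ℝ)|) * ‖hat ψ p‖ := by ring
      _ ≤ 4 * Real.pi ^ 2 * ((p.1 : ℝ) ^ 2 + (p.2 : ℝ) ^ 2) * ‖hat ψ p‖ := by
        gcongr
        nlinarith [norm_nonneg p]

lemma hat_lap_zero {N : ℕ} (f : Grid N) : hat (lap f) 0 = 0 := by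
  rw [hat_lap f (by simp [mem_freq2])]
  simp

/-- The coefficients of the nonlinear term are dominated by an aliased convolution. -/
lemma norm_hat_adv_le {N : ℕ} (ψ w : Grid N) {k : ℤ × ℤ} (hk : k ∈ freq2 N) :
    ‖hat (adv (-Dy ψ) (Dx ψ) w) k‖ ≤ ∑ t ∈ freq2 N ×ˢ freq2 N,
      if Alias N (t.1 + t.2) k then
        (1 + 2 * ‖t.2‖ / ‖t.1‖) * ‖hat (lap ψ) t.1‖ * ‖hat w t.2‖ else 0 := by
  set u := -Dy ψ with hu
  set v := Dx ψ with hv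
  have h : hat (adv u v w) k = ∑ t ∈ freq2 N ×ˢ freq2 N,
      if Alias N (t.1 + t.2) k then
        Real.pi * I * (((t.2.1 : ℂ) + k.1) * hat u t.1 + ((t.2.2 : ℂ) + k.2) * hat v t.1)
          * hat w t.2 else 0 := by
    rw [adv_eq, hat_smul, hat_add, hat_add, hat_add, hat_Dx _ hk, hat_Dy _ hk]
    have e : ∀ f g : Grid N, f * g = fun i j => f i j * g i j := fun _ _ => rfl
    simp only [e, hat_mul, Finset.mul_sum, ← Finset.sum_add_distrib]
    refine Finset.sum_congr rfl fun t ht => ?_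
    rw [Finset.mem_product] at ht
    split_ifs
    · rw [hat_Dx _ ht.2, hat_Dy _ ht.2]
      push_cast
      ring
    · simp
  rw [h]
  refine norm_sum_le_of_le _ fun t ht => ?_
  rw [Finset.mem_product] at ht
  split_ifs with hal
  swap
  · simp
  obtain ⟨p, q⟩ := t
  dsimp only at ht hal ⊢
  have hvel := norm_hat_velocity_le ψ ht.1
  -- the velocity has mean zero; the bound holds here although `‖q‖ / 0 = 0`
  by_cases hp : p = 0
  · have hu0 : hat u p = 0 := by rw [hu, hat_neg, hat_Dy _ ht.1, hp]; simp
    have hv0 : hat v p = 0 := by rw [hv, hat_Dx _ ht.1, hp]; simp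
    rw [hu0, hv0, mul_zero, mul_zero, add_zero, mul_zero, zero_mul, norm_zero]
    positivity
  have hp1 := one_le_norm hp
  have hpi := Real.pi_pos
  have hk1 := norm_le_of_alias hk hal
  have hun : ‖hat u p‖ ≤ ‖hat (lap ψ) p‖ / (2 * Real.pi * ‖p‖) := by
    rw [le_div_iff₀ (by positivity), hu, hat_neg, norm_neg]
    linarith [hvel.2]
  have hvn : ‖hat v p‖ ≤ ‖hat (lap ψ) p‖ / (2 * Real.pi * ‖p‖) := by
    rw [le_div_iff₀ (by positivity)]
    linarith [hvel.1]
  have ha : ‖(q.1 : ℂ) + k.1‖ ≤ ‖p‖ + 2 * ‖q‖ := by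
    refine (norm_add_le _ _).trans ?_
    rw [norm_intCast, norm_intCast]
    linarith [abs_fst_le_norm q]
  have hb : ‖(q.2 : ℂ) + k.2‖ ≤ ‖p‖ + 2 * ‖q‖ := by
    refine (norm_add_le _ _).trans ?_
    rw [norm_intCast, norm_intCast]
    linarith [abs_snd_le_norm q]
  rw [norm_mul, norm_mul, norm_mul, norm_real, norm_I, mul_one, Real.norm_of_nonneg hpi.le]
  calc _ ≤ Real.pi * ((‖p‖ + 2 * ‖q‖) * (‖hat (lap ψ) p‖ / (2 * Real.pi * ‖p‖))
          + (‖p‖ + 2 * ‖q‖) * (‖hat (lap ψ) p‖ / (2 * Real.pi * ‖p‖))) * ‖hat w q‖ := by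
        refine mul_le_mul_of_nonneg_right (mul_le_mul_of_nonneg_left ?_ hpi.le) (norm_nonneg _)
        refine (norm_add_le _ _).trans ?_
        rw [norm_mul, norm_mul]
        gcongr
    _ = _ := by
        field_simp
        ring

/-! ### Lattice sums and aliased convolutions -/

lemma summable_inv_norm_cube : Summable fun k : ℤ × ℤ => (‖k‖ ^ 3)⁻¹ := by
  have h := EisensteinSeries.summable_one_div_norm_rpow (k := 3) (by norm_num)
  have h2 := (finTwoArrowEquiv ℤ).symm.summable_iff.2 h
  refine h2.congr fun k => ?_
  have : ‖(finTwoArrowEquiv ℤ).symm k‖ = ‖k‖ := by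
    rw [EisensteinSeries.norm_eq_max_natAbs, Prod.norm_def]
    simp [Int.norm_eq_abs, Nat.cast_natAbs]
  rw [Function.comp_apply, this, Real.rpow_neg (norm_nonneg _)]
  norm_cast

/-- The lattice sum `∑ |k|⁻³` over the nonzero frequencies. -/
noncomputable def latticeSum : ℝ := ∑' k : ℤ × ℤ, (‖k‖ ^ 3)⁻¹

lemma latticeSum_nonneg : 0 ≤ latticeSum := tsum_nonneg fun _ => by positivity

lemma sum_inv_norm_cube_le (T : Finset (ℤ × ℤ)) : ∑ k ∈ T, (‖k‖ ^ 3)⁻¹ ≤ latticeSum :=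
  summable_inv_norm_cube.sum_le_tsum T fun _ _ => by positivity

lemma sum_ite_le_of_unique {ι : Type*} (T : Finset ι) (P : ι → Prop) [DecidablePred P] {c : ℝ}
    (hc : 0 ≤ c) (hP : ∀ x ∈ T, ∀ y ∈ T, P x → P y → x = y) :
    ∑ x ∈ T, (if P x then c else 0) ≤ c := by
  rw [← Finset.sum_filter, Finset.sum_const, nsmul_eq_mul]
  have : (T.filter P).card ≤ 1 := by
    rw [Finset.card_le_one]
    intro x hx y hy
    rw [Finset.mem_filter] at hx hy
    exact hP x hx.1 y hy.1 hx.2 hy.2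
  have h1 : ((T.filter P).card : ℝ) ≤ 1 := by exact_mod_cast this
  nlinarith

lemma Alias.unique {N : ℕ} {s k k' : ℤ × ℤ} (hk : k ∈ freq2 N) (hk' : k' ∈ freq2 N)
    (h : Alias N s k) (h' : Alias N s k') : k = k' := by
  refine Alias.eq hk hk' ⟨?_, ?_⟩
  · have := dvd_sub h'.1 h.1
    rwa [sub_sub_sub_cancel_left] at this
  · have := dvd_sub h'.2 h.2
    rwa [sub_sub_sub_cancel_left] at this

lemma Alias.unique_right {N : ℕ} {p q q' k : ℤ × ℤ} (hq : q ∈ freq2 N) (hq' : q' ∈ freq2 N)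
    (h : Alias N (p + q) k) (h' : Alias N (p + q') k) : q = q' := by
  refine Alias.eq hq hq' ⟨?_, ?_⟩
  · have := dvd_sub h.1 h'.1
    rwa [sub_sub_sub_cancel_right, Prod.fst_add, Prod.fst_add, add_sub_add_left_eq_sub] at this
  · have := dvd_sub h.2 h'.2
    rwa [sub_sub_sub_cancel_right, Prod.snd_add, Prod.snd_add, add_sub_add_left_eq_sub] at this

/-- Weighted `ℓ²` estimate for aliased convolutions, by the Cauchy-Schwarz inequality. -/
lemma sum_alias_conv_sq_le {N : ℕ} (a b A B : ℤ × ℤ → ℝ) (m : ℤ × ℤ → ℤ × ℤ → ℝ) {c : ℝ}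
    (hc : 0 ≤ c) (ha : a 0 = 0) (hb : b 0 = 0) (hA : ∀ p, 0 ≤ A p) (hB : ∀ q, 0 ≤ B q)
    (hm : ∀ p q, p ≠ 0 → q ≠ 0 →
      m p q ^ 2 ≤ A p * B q * (c * (‖p‖ ^ 3)⁻¹ + c * (‖q‖ ^ 3)⁻¹)) :
    ∑ k ∈ freq2 N, (∑ t ∈ freq2 N ×ˢ freq2 N,
        if Alias N (t.1 + t.2) k then m t.1 t.2 * a t.1 * b t.2 else 0) ^ 2
      ≤ 2 * c * latticeSum * (∑ p ∈ freq2 N, A p * a p ^ 2) * ∑ q ∈ freq2 N, B q * b q ^ 2 := by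
  have hg : ∀ k ∈ freq2 N, ∑ t ∈ freq2 N ×ˢ freq2 N,
      (if Alias N (t.1 + t.2) k then c * (‖t.1‖ ^ 3)⁻¹ + c * (‖t.2‖ ^ 3)⁻¹ else 0)
        ≤ 2 * c * latticeSum := by
    intro k _
    have hsplit : ∀ t : (ℤ × ℤ) × (ℤ × ℤ),
        (if Alias N (t.1 + t.2) k then c * (‖t.1‖ ^ 3)⁻¹ + c * (‖t.2‖ ^ 3)⁻¹ else 0)
          = (if Alias N (t.1 + t.2) k then c * (‖t.1‖ ^ 3)⁻¹ else 0)
            + (if Alias N (t.1 + t.2) k then c * (‖t.2‖ ^ 3)⁻¹ else 0) := by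
      intro t; split_ifs <;> simp
    simp only [hsplit, Finset.sum_add_distrib]
    have h1 : ∑ t ∈ freq2 N ×ˢ freq2 N,
        (if Alias N (t.1 + t.2) k then c * (‖t.1‖ ^ 3)⁻¹ else 0) ≤ c * latticeSum := by
      rw [Finset.sum_product]
      refine le_trans (Finset.sum_le_sum fun p _ => ?_)
        ((Finset.mul_sum _ _ c).symm.trans_le
          (mul_le_mul_of_nonneg_left (sum_inv_norm_cube_le (freq2 N)) hc))
      exact sum_ite_le_of_unique _ (fun q => Alias N (p + q) k)
        (c := c * (‖p‖ ^ 3)⁻¹) (by positivity) fun q hq q' hq' h h' => Alias.unique_right hq hq' h h'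
    have h2 : ∑ t ∈ freq2 N ×ˢ freq2 N,
        (if Alias N (t.1 + t.2) k then c * (‖t.2‖ ^ 3)⁻¹ else 0) ≤ c * latticeSum := by
      rw [Finset.sum_product_right]
      refine le_trans (Finset.sum_le_sum fun p _ => ?_)
        ((Finset.mul_sum _ _ c).symm.trans_le
          (mul_le_mul_of_nonneg_left (sum_inv_norm_cube_le (freq2 N)) hc))
      refine sum_ite_le_of_unique _ (fun q => Alias N (q + p) k)
        (c := c * (‖p‖ ^ 3)⁻¹) (by positivity) fun q hq q' hq' h h' => Alias.unique_right (p := p) (k := k) hq hq' ?_ ?_ <;>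
        rwa [add_comm]
    linarith
  have hf : ∑ k ∈ freq2 N, ∑ t ∈ freq2 N ×ˢ freq2 N,
      (if Alias N (t.1 + t.2) k then (A t.1 * a t.1 ^ 2) * (B t.2 * b t.2 ^ 2) else 0)
        ≤ (∑ p ∈ freq2 N, A p * a p ^ 2) * ∑ q ∈ freq2 N, B q * b q ^ 2 := by
    rw [Finset.sum_comm, Finset.sum_mul_sum,
      ← Finset.sum_product' (freq2 N) (freq2 N) fun i j => A i * a i ^ 2 * (B j * b j ^ 2)]
    refine Finset.sum_le_sum fun t _ => ?_
    have := hA t.1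
    have := hB t.2
    exact sum_ite_le_of_unique _ (fun k => Alias N (t.1 + t.2) k) (by positivity)
      fun k hk k' hk' h h' => Alias.unique hk hk' h h'
  have hS : 0 ≤ 2 * c * latticeSum := by have := latticeSum_nonneg; positivity
  have key : ∀ k ∈ freq2 N, (∑ t ∈ freq2 N ×ˢ freq2 N,
        if Alias N (t.1 + t.2) k then m t.1 t.2 * a t.1 * b t.2 else 0) ^ 2
      ≤ 2 * c * latticeSum * ∑ t ∈ freq2 N ×ˢ freq2 N,
      (if Alias N (t.1 + t.2) k then (A t.1 * a t.1 ^ 2) * (B t.2 * b t.2 ^ 2) else 0) := by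
    intro k hk
    have hnn : ∀ t : (ℤ × ℤ) × (ℤ × ℤ),
        0 ≤ (if Alias N (t.1 + t.2) k then (A t.1 * a t.1 ^ 2) * (B t.2 * b t.2 ^ 2) else 0) := by
      intro t
      have := hA t.1
      have := hB t.2
      split_ifs <;> positivity
    refine (Finset.sum_sq_le_sum_mul_sum_of_sq_le_mul _
      (f := fun t : (ℤ × ℤ) × (ℤ × ℤ) =>
        if Alias N (t.1 + t.2) k then c * (‖t.1‖ ^ 3)⁻¹ + c * (‖t.2‖ ^ 3)⁻¹ else 0)
      (g := fun t => if Alias N (t.1 + t.2) k then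
        (A t.1 * a t.1 ^ 2) * (B t.2 * b t.2 ^ 2) else 0)
      (fun t _ => ?_) (fun t _ => hnn t) (fun t _ => ?_)).trans
      (mul_le_mul_of_nonneg_right (hg k hk) (Finset.sum_nonneg fun t _ => hnn t))
    · split_ifs <;> positivity
    · split_ifs
      · by_cases h1 : t.1 = 0
        · simp [h1, ha]
        by_cases h2 : t.2 = 0
        · simp [h2, hb]
        calc (m t.1 t.2 * a t.1 * b t.2) ^ 2 = m t.1 t.2 ^ 2 * (a t.1 ^ 2 * b t.2 ^ 2) := by ring
          _ ≤ _ := mul_le_mul_of_nonneg_right (hm _ _ h1 h2) (by positivity)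
          _ = _ := by ring
      · simp
  refine (Finset.sum_le_sum key).trans ?_
  rw [← Finset.mul_sum, mul_assoc (2 * c * latticeSum)]
  exact mul_le_mul_of_nonneg_left hf hS

/-! ### Estimates of the nonlinear term -/

lemma inner2_adv_le_of_weights {N : ℕ} (ψ w : Grid N) (hw : hat w 0 = 0) (A B : ℤ × ℤ → ℝ)
    {c : ℝ} (hc : 0 ≤ c) (hA : ∀ p, 0 ≤ A p) (hB : ∀ q, 0 ≤ B q)
    (hm : ∀ p q : ℤ × ℤ, p ≠ 0 → q ≠ 0 →
      (1 + 2 * ‖q‖ / ‖p‖) ^ 2 ≤ A p * B q * (c * (‖p‖ ^ 3)⁻¹ + c * (‖q‖ ^ 3)⁻¹)) :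
    inner2 (adv (-Dy ψ) (Dx ψ) w) (adv (-Dy ψ) (Dx ψ) w)
      ≤ 2 * c * latticeSum * (∑ p ∈ freq2 N, A p * ‖hat (lap ψ) p‖ ^ 2)
        * ∑ q ∈ freq2 N, B q * ‖hat w q‖ ^ 2 := by
  rw [inner2_self]
  refine le_trans (Finset.sum_le_sum fun k hk => ?_)
    (sum_alias_conv_sq_le (fun p => ‖hat (lap ψ) p‖) (fun q => ‖hat w q‖) A B
      (fun p q => 1 + 2 * ‖q‖ / ‖p‖) hc (by simp [hat_lap_zero]) (by simp [hw]) hA hB hm)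
  exact pow_le_pow_left₀ (norm_nonneg _) (norm_hat_adv_le ψ w hk) 2

lemma sum_norm_sq_le_innerH1 {N : ℕ} (f : Grid N) :
    ∑ k ∈ freq2 N, ‖k‖ ^ 2 * ‖hat f k‖ ^ 2 ≤ innerH1 f f := by
  rw [innerH1_self]
  refine Finset.sum_le_sum fun k _ => mul_le_mul_of_nonneg_right ?_ (by positivity)
  have h1 := norm_sq_le k
  have h2 : 1 ≤ 4 * Real.pi ^ 2 := by nlinarith [Real.pi_gt_three]
  nlinarith [sq_nonneg ‖k‖]

/-- The nonlinear term is bounded in `L²` by the `H¹` norms of both factors. -/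
lemma inner2_adv_le_H1 {N : ℕ} (ψ w : Grid N) (hw : hat w 0 = 0) :
    inner2 (adv (-Dy ψ) (Dx ψ) w) (adv (-Dy ψ) (Dx ψ) w)
      ≤ 20 * latticeSum * innerH1 (lap ψ) (lap ψ) * innerH1 w w := by
  have hS := latticeSum_nonneg
  refine (inner2_adv_le_of_weights ψ w hw (fun p => ‖p‖ ^ 2) (fun q => ‖q‖ ^ 2) (c := 10)
    (by norm_num) (fun _ => by positivity) (fun _ => by positivity) ?_).trans ?_
  · intro p q hp hq
    have hP := one_le_norm hp
    have hQ := one_le_norm hq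
    set P := ‖p‖
    set Q := ‖q‖
    have e1 : (1 + 2 * Q / P) ^ 2 = (P + 2 * Q) ^ 2 * Q / (P ^ 2 * Q) := by
      field_simp
    have e2 : P ^ 2 * Q ^ 2 * (10 * (P ^ 3)⁻¹ + 10 * (Q ^ 3)⁻¹)
        = 10 * (P * Q ^ 3 + P ^ 4) / (P ^ 2 * Q) := by
      field_simp
    rw [e1, e2]
    refine div_le_div_of_nonneg_right ?_ (by positivity)
    have h1 : Q ^ 3 ≤ P * Q ^ 3 := le_mul_of_one_le_left (by positivity) hP
    have h2 : P ^ 2 * Q ≤ P * Q ^ 3 + P ^ 4 := by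
      rcases le_total P (Q ^ 2) with h | h
      · have : P ^ 2 * Q ≤ P * Q ^ 3 := by
          calc P ^ 2 * Q = P * Q * P := by ring
            _ ≤ P * Q * Q ^ 2 := by gcongr
            _ = _ := by ring
        nlinarith [pow_pos (by linarith : 0 < P) 4]
      · have hQP : Q ≤ P ^ 2 := by nlinarith
        have : P ^ 2 * Q ≤ P ^ 2 * P ^ 2 := by gcongr
        nlinarith [mul_pos (by linarith : 0 < P) (pow_pos (by linarith : 0 < Q) 3)]
    have h3 : 0 ≤ Q * (P - 2 * Q) ^ 2 := by positivity
    nlinarith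
  · have h1 := sum_norm_sq_le_innerH1 (lap ψ)
    have h2 := sum_norm_sq_le_innerH1 w
    have h3 := innerH1_self_nonneg (lap ψ)
    have h4 : 0 ≤ ∑ k ∈ freq2 N, ‖k‖ ^ 2 * ‖hat w k‖ ^ 2 :=
      Finset.sum_nonneg fun k _ => mul_nonneg (sq_nonneg _) (sq_nonneg _)
    have h5 := mul_le_mul h1 h2 h4 h3
    rw [mul_assoc (2 * 10 * latticeSum)]
    refine (mul_le_mul_of_nonneg_left h5 (by positivity)).trans_eq ?_
    ring

lemma pow_three_le {x e : ℝ} (hx : 0 ≤ x) (he : 0 < e) : x ^ 3 ≤ e * x ^ 4 + (e⁻¹) ^ 3 := by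
  rcases le_total (e⁻¹) x with h | h
  · have h1 : 1 ≤ e * x := by
      calc (1 : ℝ) = e * e⁻¹ := (mul_inv_cancel₀ he.ne').symm
        _ ≤ e * x := by gcongr
    have h2 : x ^ 3 ≤ x ^ 3 * (e * x) := le_mul_of_one_le_right (by positivity) h1
    have : 0 < (e⁻¹) ^ 3 := by positivity
    nlinarith
  · have h1 : x ^ 3 ≤ (e⁻¹) ^ 3 := by gcongr
    have : 0 ≤ e * x ^ 4 := by positivity
    linarith

/-- The nonlinear term is bounded in `L²` by the `L²` norm of the vorticity and an arbitrarily
small multiple of the `H²` norm of the advected quantity. -/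
lemma inner2_adv_le_H2 {N : ℕ} (ψ w : Grid N) (hw : hat w 0 = 0) {e : ℝ} (he : 0 < e) :
    inner2 (adv (-Dy ψ) (Dx ψ) w) (adv (-Dy ψ) (Dx ψ) w)
      ≤ 20 * latticeSum * inner2 (lap ψ) (lap ψ)
        * (e * inner2 (lap w) (lap w) + (e⁻¹) ^ 3 * inner2 w w) := by
  have hS := latticeSum_nonneg
  refine (inner2_adv_le_of_weights ψ w hw (fun _ => 1) (fun q => ‖q‖ ^ 3) (c := 10)
    (by norm_num) (fun _ => by positivity) (fun _ => by positivity) ?_).trans ?_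
  · intro p q hp hq
    have hP := one_le_norm hp
    have hQ := one_le_norm hq
    set P := ‖p‖
    set Q := ‖q‖
    have hx : 0 ≤ Q / P := by positivity
    have e2 : 1 * Q ^ 3 * (10 * (P ^ 3)⁻¹ + 10 * (Q ^ 3)⁻¹) = 10 * (Q / P) ^ 3 + 10 := by
      field_simp
    rw [e2, mul_div_assoc]
    set x := Q / P
    nlinarith [mul_nonneg hx (sq_nonneg (x - 1)), sq_nonneg (x - 1)]
  · have h1 : ∑ p ∈ freq2 N, 1 * ‖hat (lap ψ) p‖ ^ 2 = inner2 (lap ψ) (lap ψ) := by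
      rw [inner2_self]
      simp
    have h2 : ∑ q ∈ freq2 N, ‖q‖ ^ 3 * ‖hat w q‖ ^ 2
        ≤ e * inner2 (lap w) (lap w) + (e⁻¹) ^ 3 * inner2 w w := by
      rw [inner2_lap_self, inner2_self, Finset.mul_sum, Finset.mul_sum, ← Finset.sum_add_distrib]
      refine Finset.sum_le_sum fun k _ => ?_
      have h3 := pow_three_le (norm_nonneg k) he
      have h4 : ‖k‖ ^ 4 ≤ (4 * Real.pi ^ 2 * ((k.1 : ℝ) ^ 2 + (k.2 : ℝ) ^ 2)) ^ 2 := by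
        rw [show ‖k‖ ^ 4 = (‖k‖ ^ 2) ^ 2 by ring]
        refine pow_le_pow_left₀ (by positivity) ?_ 2
        have h1 := norm_sq_le k
        have h2 : 1 ≤ 4 * Real.pi ^ 2 := by nlinarith [Real.pi_gt_three]
        nlinarith [sq_nonneg ‖k‖]
      rw [← mul_assoc e, ← add_mul]
      refine mul_le_mul_of_nonneg_right (h3.trans ?_) (by positivity)
      gcongr
    rw [h1]
    have h3 := inner2_self_nonneg (lap ψ)
    exact (mul_le_mul_of_nonneg_left h2 (by positivity)).trans_eq (by ring)

/-! ### Energy estimates for one time step -/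

/-- The constant in the estimates of the nonlinear term. -/
noncomputable def advConst : ℝ := 1 + 20 * latticeSum

lemma one_le_advConst : 1 ≤ advConst := by
  have := latticeSum_nonneg
  unfold advConst
  linarith

lemma inner2_neg_self {N : ℕ} (f : Grid N) : inner2 (-f) (-f) = inner2 f f := by
  rw [inner2_neg_left, inner2_neg_right, neg_neg]

lemma innerH1_neg_self {N : ℕ} (f : Grid N) : innerH1 (-f) (-f) = innerH1 f f := by
  rw [innerH1_self, innerH1_self]
  simp only [hat_neg, norm_neg]

lemma advection_le_H1 {N : ℕ} {a ψ : Grid N} (w : Grid N) (ha : a = -lap ψ) (hw : hat w 0 = 0) :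
    inner2 (adv (-Dy ψ) (Dx ψ) w) (adv (-Dy ψ) (Dx ψ) w)
      ≤ advConst * innerH1 a a * innerH1 w w := by
  refine (inner2_adv_le_H1 ψ w hw).trans ?_
  rw [ha, innerH1_neg_self, mul_assoc, mul_assoc advConst]
  refine mul_le_mul_of_nonneg_right ?_
    (mul_nonneg (innerH1_self_nonneg _) (innerH1_self_nonneg _))
  unfold advConst
  linarith

lemma advection_le_H2 {N : ℕ} {a ψ : Grid N} (w : Grid N) (ha : a = -lap ψ) (hw : hat w 0 = 0)
    {e : ℝ} (he : 0 < e) :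
    inner2 (adv (-Dy ψ) (Dx ψ) w) (adv (-Dy ψ) (Dx ψ) w)
      ≤ advConst * inner2 a a * (e * inner2 (lap w) (lap w) + (e⁻¹) ^ 3 * inner2 w w) := by
  refine (inner2_adv_le_H2 ψ w hw he).trans ?_
  have h1 := inner2_self_nonneg (lap ψ)
  have h2 := inner2_self_nonneg (lap w)
  have h3 := inner2_self_nonneg w
  rw [ha, inner2_neg_self]
  have h4 : 20 * latticeSum ≤ advConst := by
    unfold advConst
    linarith
  have h5 : 0 ≤ e * inner2 (lap w) (lap w) + (e⁻¹) ^ 3 * inner2 w w :=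
    add_nonneg (mul_nonneg he.le h2) (mul_nonneg (pow_nonneg (inv_nonneg.2 he.le) 3) h3)
  exact mul_le_mul_of_nonneg_right (mul_le_mul_of_nonneg_right h4 h1) h5

lemma c0_pos : 0 < c0 := by
  have := Real.pi_pos
  unfold c0
  positivity

/-- The `L²` energy estimate. The nonlinear term tested with `w` reduces to its pairing with the
increment `w - a`, which is absorbed by numerical dissipation and viscosity. -/
lemma energy_L2 {N : ℕ} {ν dt F : ℝ} {f a w ψ : Grid N} (hν : 0 < ν) (hdt : 0 < dt)
    (ha : a = -lap ψ) (hw : hat w 0 = 0) (hf : inner2 f f ≤ F ^ 2)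
    (heq : w - a + dt • adv (-Dy ψ) (Dx ψ) a = (dt * ν) • lap w + dt • f)
    (hstep : dt * (advConst * innerH1 a a) ≤ ν / 4) :
    inner2 w w + ν / 2 * dt * innerH1 w w ≤ inner2 a a + c0 ^ 2 / ν * F ^ 2 * dt := by
  set T := fun g => adv (-Dy ψ) (Dx ψ) g with hT
  have hc0 := c0_pos
  have h1 := congrArg (fun g => inner2 g w) heq
  simp only [inner2_add_left, inner2_smul_left] at h1
  have h2 : inner2 (adv (-Dy ψ) (Dx ψ) a) w = inner2 (w - a) (T w) := by
    have e : a = w - (w - a) := by abel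
    conv_lhs => rw [e]
    rw [adv_sub, inner2_sub_left, inner2_adv_self, inner2_adv]
    ring
  have h3 := inner2_sub_self w a
  have h4 : inner2 (lap w) w = -innerH1 w w := by rw [inner2_comm, inner2_lap]
  have h5 := two_mul_inner2_le (-(w - a)) (dt • T w) one_pos
  rw [inner2_neg_self, inner2_neg_left, inner2_comm _ (dt • T w), inner2_smul_left,
    inner2_smul_left, inner2_comm _ (dt • T w), inner2_smul_left, inner2_comm (T w) (w - a)] at h5
  have h6 := two_mul_inner2_le f w (e := c0 ^ 2 / ν) (by positivity)
  have h7 := inner2_le_innerH1 hw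
  have h8 : (c0 ^ 2 / ν)⁻¹ * inner2 w w ≤ ν * innerH1 w w := by
    calc _ ≤ (c0 ^ 2 / ν)⁻¹ * (c0 ^ 2 * innerH1 w w) := by gcongr
      _ = _ := by field_simp
  have h9 : c0 ^ 2 / ν * inner2 f f ≤ c0 ^ 2 / ν * F ^ 2 := by gcongr
  have h10 : 2 * dt * inner2 f w ≤ dt * (c0 ^ 2 / ν * F ^ 2 + ν * innerH1 w w) := by
    calc 2 * dt * inner2 f w = dt * (2 * inner2 f w) := by ring
      _ ≤ _ := by gcongr; linarith
  have h11 : dt * (dt * inner2 (T w) (T w)) ≤ dt * (ν / 4 * innerH1 w w) := by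
    have hE := innerH1_self_nonneg w
    refine mul_le_mul_of_nonneg_left ?_ hdt.le
    calc dt * inner2 (T w) (T w) ≤ dt * (advConst * innerH1 a a * innerH1 w w) := by
          gcongr; exact advection_le_H1 w ha hw
      _ = dt * (advConst * innerH1 a a) * innerH1 w w := by ring
      _ ≤ _ := by gcongr
  have h12 : 0 ≤ dt * (ν * innerH1 w w) := by
    have := innerH1_self_nonneg w
    positivity
  rw [h2, h4] at h1
  nlinarith

/-- The `H¹` energy estimate. After replacing the old by the new vorticity as the advected
quantity, the nonlinear term is controlled by viscosity and the `L²` bound `X`. -/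
lemma energy_H1 {N : ℕ} {ν dt F X : ℝ} {f a w ψ : Grid N} (hν : 0 < ν) (hdt : 0 < dt)
    (ha : a = -lap ψ) (hw : hat w 0 = 0) (hf : inner2 f f ≤ F ^ 2)
    (heq : w - a + dt • adv (-Dy ψ) (Dx ψ) a = (dt * ν) • lap w + dt • f)
    (hstep : dt * (advConst * innerH1 a a) ≤ ν / 4) (hX : 0 < X)
    (haX : inner2 a a ≤ X) (hwX : inner2 w w ≤ X) :
    innerH1 w w + ν * dt * inner2 (lap w) (lap w)
      ≤ innerH1 a a + dt * (16384 * advConst ^ 4 / ν ^ 7 * X ^ 5 + 4 / ν * F ^ 2) := by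
  set T := fun g => adv (-Dy ψ) (Dx ψ) g with hT
  set H := inner2 (lap w) (lap w) with hH
  have hH0 : 0 ≤ H := inner2_self_nonneg _
  have hC : 0 < advConst := by linarith [one_le_advConst]
  have h1 := congrArg (fun g => inner2 g (lap w)) heq
  simp only [inner2_add_left, inner2_smul_left, inner2_lap (w - a) w] at h1
  have h2 : adv (-Dy ψ) (Dx ψ) a = T w - T (w - a) := by
    rw [hT]
    simp only [← adv_sub]
    congr 1
    abel
  rw [h2, inner2_sub_left] at h1
  have h3 := innerH1_sub_self w a
  have h0 : hat (w - a) 0 = 0 := by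
    rw [hat_sub, hw, ha, hat_neg, hat_lap_zero, neg_zero, sub_zero]
  have he : 0 < 4 / ν := by positivity
  have hinv : (4 / ν)⁻¹ = ν / 4 := inv_div _ _
  -- the forcing
  have h4 : -(2 * inner2 f (lap w)) ≤ 4 / ν * F ^ 2 + ν / 4 * H := by
    have := two_mul_inner2_le (-f) (lap w) he
    rw [inner2_neg_self, inner2_neg_left, hinv] at this
    have : 4 / ν * inner2 f f ≤ 4 / ν * F ^ 2 := by gcongr
    linarith
  -- advection of the increment
  have h5 : -(2 * dt * inner2 (T (w - a)) (lap w))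
      ≤ innerH1 (w - a) (w - a) + dt * (ν / 4 * H) := by
    have := two_mul_inner2_le (-T (w - a)) (lap w) he
    rw [inner2_neg_self, inner2_neg_left, hinv] at this
    have hE := innerH1_self_nonneg (w - a)
    have h6 : dt * (4 / ν * inner2 (T (w - a)) (T (w - a))) ≤ innerH1 (w - a) (w - a) := by
      calc _ ≤ dt * (4 / ν * (advConst * innerH1 a a * innerH1 (w - a) (w - a))) := by
            gcongr; exact advection_le_H1 (w - a) ha h0
        _ = dt * (advConst * innerH1 a a) * (4 / ν * innerH1 (w - a) (w - a)) := by ring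
        _ ≤ ν / 4 * (4 / ν * innerH1 (w - a) (w - a)) := by gcongr
        _ = _ := by field_simp
    have h7 := mul_le_mul_of_nonneg_left this hdt.le
    nlinarith
  -- advection of the new vorticity
  have h8 : 2 * inner2 (T w) (lap w)
      ≤ ν / 2 * H + 16384 * advConst ^ 4 / ν ^ 7 * X ^ 5 := by
    have h9 := two_mul_inner2_le (T w) (lap w) he
    rw [hinv] at h9
    -- this `e` balances the `H²` part of the nonlinear term against `ν / 4`
    set e := ν ^ 2 / (16 * advConst * X) with hedef
    have hepos : 0 < e := by positivity
    have h10 := advection_le_H2 w ha hw hepos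
    have h11 : 4 / ν * inner2 (T w) (T w)
        ≤ 4 / ν * (advConst * X * (e * H + (e⁻¹) ^ 3 * X)) := by
      refine mul_le_mul_of_nonneg_left (h10.trans ?_) he.le
      have := inner2_self_nonneg w
      gcongr
    have h12 : 4 / ν * (advConst * X * (e * H + (e⁻¹) ^ 3 * X))
        = ν / 4 * H + 16384 * advConst ^ 4 / ν ^ 7 * X ^ 5 := by
      rw [hedef]
      field_simp
      ring
    linarith
  have h13 := mul_le_mul_of_nonneg_left h4 hdt.le
  have h14 := mul_le_mul_of_nonneg_left h8 hdt.le
  nlinarith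

section Solution

variable {N : ℕ} {ν dt F : ℝ} {f ω ψ u v : ℕ → Grid N}

lemma IsSolution.vorticity_eq (h : IsSolution ν dt f ω ψ u v) (n : ℕ) : ω n = -lap (ψ n) :=
  funext fun i => funext fun j => (h.stream n i j).symm

lemma IsSolution.hat_zero (h : IsSolution ν dt f ω ψ u v) (n : ℕ) : hat (ω n) 0 = 0 := by
  rw [h.vorticity_eq, hat_neg, hat_lap_zero, neg_zero]

lemma IsSolution.step (h : IsSolution ν dt f ω ψ u v) (hdt : 0 < dt) (n : ℕ) :
    ω (n + 1) - ω n + dt • adv (-Dy (ψ n)) (Dx (ψ n)) (ω n)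
      = (dt * ν) • lap (ω (n + 1)) + dt • f n := by
  have hu : u n = -Dy (ψ n) := funext fun i => funext fun j => h.velocity_x n i j
  have hv : v n = Dx (ψ n) := funext fun i => funext fun j => h.velocity_y n i j
  rw [← hu, ← hv]
  funext i j
  have := h.vorticity n i j
  simp only [Pi.add_apply, Pi.sub_apply, Pi.smul_apply, smul_eq_mul]
  have h2 : ω (n + 1) i j - ω n i j = dt * ((ω (n + 1) i j - ω n i j) / dt) := by
    field_simp
  rw [h2]
  unfold adv
  linear_combination dt * this

lemma IsSolution.energy_L2 (h : IsSolution ν dt f ω ψ u v) (hν : 0 < ν) (hdt : 0 < dt)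
    (hf : ∀ n, normL2 (f n) ≤ F) (n : ℕ) (hstep : dt * (advConst * normH1 (ω n) ^ 2) ≤ ν / 4) :
    normL2 (ω (n + 1)) ^ 2 + ν / 2 * dt * normH1 (ω (n + 1)) ^ 2
      ≤ normL2 (ω n) ^ 2 + c0 ^ 2 / ν * F ^ 2 * dt := by
  have hf' : inner2 (f n) (f n) ≤ F ^ 2 := by
    rw [← normL2_sq]
    exact pow_le_pow_left₀ (Real.sqrt_nonneg _) (hf n) 2
  rw [normH1_sq] at hstep
  rw [normL2_sq, normL2_sq, normH1_sq]
  exact CollocNS.energy_L2 hν hdt (h.vorticity_eq n) (h.hat_zero _) hf' (h.step hdt n) hstep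

lemma IsSolution.energy_H1 (h : IsSolution ν dt f ω ψ u v) (hν : 0 < ν) (hdt : 0 < dt)
    (hf : ∀ n, normL2 (f n) ≤ F) (n : ℕ) (hstep : dt * (advConst * normH1 (ω n) ^ 2) ≤ ν / 4)
    {X : ℝ} (hX : 0 < X) (h0 : normL2 (ω n) ^ 2 ≤ X) (h1 : normL2 (ω (n + 1)) ^ 2 ≤ X) :
    normH1 (ω (n + 1)) ^ 2 + ν * dt * normH2 (ω (n + 1)) ^ 2
      ≤ normH1 (ω n) ^ 2
        + dt * (16384 * advConst ^ 4 / ν ^ 7 * X ^ 5 + 4 / ν * F ^ 2) := by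
  have hf' : inner2 (f n) (f n) ≤ F ^ 2 := by
    rw [← normL2_sq]
    exact pow_le_pow_left₀ (Real.sqrt_nonneg _) (hf n) 2
  rw [normH1_sq] at hstep
  rw [normL2_sq] at h0 h1
  rw [normH1_sq, normH1_sq, normH2, normL2_sq]
  exact CollocNS.energy_H1 hν hdt (h.vorticity_eq n) (h.hat_zero _) hf' (h.step hdt n) hstep hX
    h0 h1

lemma IsSolution.poincare_L2 (h : IsSolution ν dt f ω ψ u v) (n : ℕ) :
    normL2 (ω n) ^ 2 ≤ c0 ^ 2 * normH1 (ω n) ^ 2 := by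
  rw [normL2_sq, normH1_sq]
  exact inner2_le_innerH1 (h.hat_zero n)

end Solution

lemma poincare_H1 {N : ℕ} (w : Grid N) : normH1 w ^ 2 ≤ c0 ^ 2 * normH2 w ^ 2 := by
  rw [normH1_sq, normH2, normL2_sq]
  exact innerH1_le_lap w

/-! ### The constants -/

/-- The limiting value `2 c₀⁴ F² / ν²` of the squared `L²` norm of the vorticity. -/
noncomputable def absorbL2 (ν F : ℝ) : ℝ := 2 * c0 ^ 4 / ν ^ 2 * F ^ 2

/-- The growth rate of the squared `H¹` norm due to the nonlinear term, if the squared `L²` norm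
of the vorticity is at most `X`. -/
noncomputable def advRate (ν X : ℝ) : ℝ := 16384 * advConst ^ 4 / ν ^ 7 * X ^ 5

/-- The exponential rate `ν / (2 c₀²)` behind the factor `decay`. -/
noncomputable def dampRate (ν : ℝ) : ℝ := ν / (2 * c0 ^ 2)

/-- The stationary part of the `H¹` bound, independent of the initial data. -/
noncomputable def constB (ν F : ℝ) : ℝ :=
  (advRate ν (absorbL2 ν F + 1) + 4 / ν * F ^ 2) / dampRate ν

/-- The transient part of the `H¹` bound; `a` is the `L²` norm of the initial vorticity. -/
noncomputable def constA (a ν F : ℝ) : ℝ :=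
  2 * (advRate ν (absorbL2 ν F + 1 + a ^ 2) / dampRate ν)

/-- The uniform growth rate of the squared `H¹` norm; `a` is the `L²` norm of the initial
vorticity. -/
noncomputable def constK (a ν F : ℝ) : ℝ :=
  advRate ν (absorbL2 ν F + 1 + a ^ 2) + 4 / ν * F ^ 2

/-- The uniform bound; `a` is the `H¹` norm of the initial vorticity, so that `c0 * a` dominates its
`L²` norm by the Poincaré inequality. The summand `3 |ν|` makes the
restriction on the time step imply `dampRate ν * dt ≤ 1`. -/
noncomputable def constM (a ν F : ℝ) : ℝ :=
  1 + 3 * |ν| + a ^ 2 + |constB ν F| + |constA (c0 * a) ν F|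

lemma one_le_constM (a ν F : ℝ) : 1 ≤ constM a ν F := by
  unfold constM
  linarith [abs_nonneg ν, sq_nonneg a, abs_nonneg (constB ν F), abs_nonneg (constA (c0 * a) ν F)]

lemma absorbL2_nonneg (ν F : ℝ) : 0 ≤ absorbL2 ν F := by
  have := c0_pos
  unfold absorbL2
  positivity

lemma dampRate_pos {ν : ℝ} (hν : 0 < ν) : 0 < dampRate ν := by
  have := c0_pos
  unfold dampRate
  positivity

lemma advRate_nonneg {ν X : ℝ} (hν : 0 < ν) (hX : 0 ≤ X) : 0 ≤ advRate ν X := by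
  unfold advRate
  positivity

lemma advRate_mono {ν X Y : ℝ} (hν : 0 < ν) (hX : 0 ≤ X) (h : X ≤ Y) :
    advRate ν X ≤ advRate ν Y := by
  unfold advRate
  gcongr

/-- A consequence of convexity: a decaying contribution to the `L²` bound yields a decaying
contribution to the growth rate. -/
lemma advRate_add_le {ν X Y t : ℝ} (hν : 0 < ν) (hX : 0 ≤ X) (hY : 0 ≤ Y) (ht : 0 ≤ t)
    (ht1 : t ≤ 1) : advRate ν (X + t * Y) ≤ advRate ν X + t * advRate ν (X + Y) := by
  have h := (convexOn_pow 5).2 (x := X) (y := X + Y) hX (add_nonneg hX hY)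
    (sub_nonneg.2 ht1) ht (by ring)
  simp only [smul_eq_mul] at h
  have e : (1 - t) * X + t * (X + Y) = X + t * Y := by ring
  rw [e] at h
  have h2 : (X + t * Y) ^ 5 ≤ X ^ 5 + t * (X + Y) ^ 5 := by
    have : 0 ≤ t * X ^ 5 := by positivity
    linarith
  unfold advRate
  calc _ ≤ 16384 * advConst ^ 4 / ν ^ 7 * (X ^ 5 + t * (X + Y) ^ 5) := by gcongr
    _ = _ := by ring

lemma constB_nonneg {ν : ℝ} (hν : 0 < ν) (F : ℝ) : 0 ≤ constB ν F := by
  have h1 := absorbL2_nonneg ν F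
  have h2 := dampRate_pos hν
  have h3 := advRate_nonneg hν (by positivity : 0 ≤ absorbL2 ν F + 1)
  unfold constB
  positivity

lemma constA_nonneg {ν : ℝ} (hν : 0 < ν) (a F : ℝ) : 0 ≤ constA a ν F := by
  have h1 := absorbL2_nonneg ν F
  have h2 := dampRate_pos hν
  have h3 := advRate_nonneg hν (by positivity : 0 ≤ absorbL2 ν F + 1 + a ^ 2)
  unfold constA
  positivity

lemma constA_mono {ν : ℝ} (hν : 0 < ν) {a b : ℝ} (F : ℝ) (h : a ^ 2 ≤ b ^ 2) :
    constA a ν F ≤ constA b ν F := by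
  have h1 := absorbL2_nonneg ν F
  have h2 := dampRate_pos hν
  have h3 := advRate_mono hν (by positivity : 0 ≤ absorbL2 ν F + 1 + a ^ 2)
    (by linarith : absorbL2 ν F + 1 + a ^ 2 ≤ absorbL2 ν F + 1 + b ^ 2)
  unfold constA
  gcongr

lemma c0_sq_le_one : c0 ^ 2 ≤ 1 := by
  have h : c0 ≤ 1 := by
    unfold c0
    rw [div_le_one (by positivity)]
    linarith [Real.pi_gt_three]
  exact pow_le_one₀ c0_pos.le h

/-! ### Discrete Gronwall inequalities -/

lemma gronwall_step {x θ t y y' y₀ D : ℝ} (hx : 0 < x) (hθ : θ = (1 + x)⁻¹)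
    (h : y' + x * y' ≤ y + x * D) (hy : y ≤ t * y₀ + D * (1 - t)) :
    y' ≤ θ * t * y₀ + D * (1 - θ * t) := by
  have hθx : θ * (1 + x) = 1 := by rw [hθ]; exact inv_mul_cancel₀ (by positivity)
  have hθ0 : 0 < θ := by rw [hθ]; positivity
  have h1 := mul_le_mul_of_nonneg_left (h.trans (by linarith : _ ≤ t * y₀ + D * (1 - t) + x * D))
    hθ0.le
  have h2 : θ * (y' + x * y') = y' := by linear_combination y' * hθx
  have h3 : θ * (t * y₀ + D * (1 - t) + x * D) = θ * t * y₀ + D * (1 - θ * t) := by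
    linear_combination D * hθx
  linarith

/-- The damping `2 x` is twice what the factor `θ = 1 / (1 + x)` needs. The excess absorbs a
source that decays like `θⁿ` itself, with no factor `n`. -/
lemma gronwall_step_transient {x θ t y y' y₀ A B : ℝ} (hx : 0 < x) (hx1 : x ≤ 1)
    (hθ : θ = (1 + x)⁻¹) (ht : 0 ≤ t) (ht1 : t ≤ 1) (hy₀ : 0 ≤ y₀) (hA : 0 ≤ A) (hB : 0 ≤ B)
    (h : y' + 2 * x * y' ≤ y + x * (B + t * (A / 2)))
    (hy : y ≤ t * y₀ + (B + t * A) * (1 - t)) :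
    y' ≤ θ * t * y₀ + (B + θ * t * A) * (1 - θ * t) := by
  have hθx : θ * (1 + x) = 1 := by rw [hθ]; exact inv_mul_cancel₀ (by positivity)
  have hθ0 : 0 < θ := by rw [hθ]; positivity
  have hθ1 : θ ≤ 1 := by nlinarith
  have hθ2 : 1 ≤ 2 * θ := by nlinarith
  have hxθ : x * θ = 1 - θ := by linarith
  have e : (1 + 2 * x) * (θ * t * y₀ + (B + θ * t * A) * (1 - θ * t))
      - (t * y₀ + (B + t * A) * (1 - t) + x * (B + t * (A / 2)))
      = (x * θ) * (t * y₀) + x * (1 - θ * t) * B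
        + t * A * (x * (2 * θ - 1) / 2 + t * (x * θ) ^ 2) := by
    have hx' : x = θ⁻¹ - 1 := by
      field_simp
      linarith
    rw [hx']
    field_simp
    ring
  have h1 : 0 ≤ 1 - θ * t := by nlinarith
  have h2 : 0 ≤ 2 * θ - 1 := by linarith
  have h3 : 0 ≤ (x * θ) * (t * y₀) + x * (1 - θ * t) * B
        + t * A * (x * (2 * θ - 1) / 2 + t * (x * θ) ^ 2) := by positivity
  have h4 : (1 + 2 * x) * y'
      ≤ (1 + 2 * x) * (θ * t * y₀ + (B + θ * t * A) * (1 - θ * t)) := by linarith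
  exact le_of_mul_le_mul_left h4 (by positivity)

lemma sum_le_of_step {y g : ℕ → ℝ} {c k : ℝ} (hy : ∀ n, 0 ≤ y n)
    (h : ∀ n, y (n + 1) + c * g (n + 1) ≤ y n + k) {i m : ℕ} (hi : 1 ≤ i) (him : i ≤ m) :
    c * ∑ n ∈ Finset.Icc i m, g n ≤ y (i - 1) + k * ((m : ℝ) - i + 1) := by
  suffices H : y m + c * ∑ n ∈ Finset.Icc i m, g n ≤ y (i - 1) + k * ((m : ℝ) - i + 1) by
    linarith [hy m]
  induction m, him using Nat.le_induction with
  | base =>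
    have := h (i - 1)
    rw [Nat.sub_add_cancel hi] at this
    simpa using this
  | succ m him ih =>
    rw [Finset.sum_Icc_succ_top (by omega)]
    push_cast
    linarith [h m]

/-! ### Uniform estimates -/

section Solution

variable {N : ℕ} {ν dt F : ℝ} {f ω ψ u v : ℕ → Grid N}

lemma step_restriction {M E : ℝ} (hM : 1 ≤ M) (hdt : 0 < dt)
    (hstep : dt ≤ ν / (4 * advConst ^ 2 * M ^ 2)) (hE : E ≤ M ^ 2) :
    dt * (advConst * E) ≤ ν / 4 := by
  have hC := one_le_advConst
  have h1 : advConst * E ≤ advConst ^ 2 * M ^ 2 := by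
    calc advConst * E ≤ advConst * M ^ 2 := by gcongr
      _ ≤ advConst ^ 2 * M ^ 2 := by gcongr; nlinarith
  rw [le_div_iff₀ (by positivity)] at hstep
  nlinarith [mul_le_mul_of_nonneg_left h1 hdt.le]

lemma dampRate_mul_le_one {M : ℝ} (hν : 0 < ν) (hM : 3 * ν ≤ M) (hdt : 0 < dt)
    (hstep : dt ≤ ν / (4 * advConst ^ 2 * M ^ 2)) : dampRate ν * dt ≤ 1 := by
  have hC := one_le_advConst
  have hM0 : 0 < M := by linarith
  rw [le_div_iff₀ (by positivity)] at hstep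
  have h1 : 1 * (3 * ν) ^ 2 ≤ advConst ^ 2 * M ^ 2 := by
    gcongr
    exact one_le_pow₀ hC
  have h2 : dt * (36 * ν ^ 2) ≤ ν := by
    nlinarith [mul_le_mul_of_nonneg_left h1 hdt.le]
  have h3 : dt * (36 * ν) ≤ 1 := by
    refine le_of_mul_le_mul_right ?_ hν
    linarith
  have h4 : dampRate ν * dt = 2 * Real.pi ^ 2 * (dt * ν) := by
    have := Real.pi_ne_zero
    unfold dampRate c0
    field_simp
  have h5 : Real.pi ^ 2 ≤ 18 := by nlinarith [Real.pi_lt_four, Real.pi_gt_three, Real.pi_lt_d2]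
  have h6 : 0 < dt * ν := by positivity
  rw [h4]
  nlinarith

lemma decay_eq : decay ν dt = (1 + dampRate ν * dt)⁻¹ := rfl

lemma decay_pow_mem (hν : 0 < ν) (hdt : 0 < dt) (n : ℕ) :
    0 ≤ decay ν dt ^ n ∧ decay ν dt ^ n ≤ 1 := by
  have hx : 0 < dampRate ν * dt := mul_pos (dampRate_pos hν) hdt
  have h0 : 0 ≤ decay ν dt := by rw [decay_eq]; positivity
  have h1 : decay ν dt ≤ 1 := by
    rw [decay_eq]
    exact inv_le_one_of_one_le₀ (by linarith)
  exact ⟨pow_nonneg h0 n, pow_le_one₀ h0 h1⟩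

/-- The decay estimate in `H¹` at a time level gives the uniform bound there. -/
lemma normH1_sq_le_constM {t E₀ E L₀ a : ℝ} (hν : 0 < ν) (ht : 0 ≤ t) (ht1 : t ≤ 1)
    (hE₀ : E₀ = a ^ 2) (hL₀ : L₀ ^ 2 ≤ (c0 * a) ^ 2)
    (h : E ≤ t * E₀ + (constB ν F + t * constA L₀ ν F) * (1 - t)) :
    E ≤ constM a ν F ^ 2 := by
  have h1 := constA_mono hν F hL₀
  have h2 := constA_nonneg hν L₀ F
  have h3 := constB_nonneg hν F
  have h4 := one_le_constM a ν F
  have h5 : E ≤ constM a ν F := by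
    have h6 : t * E₀ ≤ a ^ 2 := by rw [hE₀]; nlinarith [sq_nonneg a]
    have h7 : t * constA L₀ ν F ≤ constA L₀ ν F := mul_le_of_le_one_left h2 ht1
    have h8 : (constB ν F + t * constA L₀ ν F) * (1 - t) ≤ constB ν F + t * constA L₀ ν F :=
      mul_le_of_le_one_right (by positivity) (by linarith)
    unfold constM
    linarith [le_abs_self (constB ν F), le_abs_self (constA (c0 * a) ν F), abs_nonneg ν]
  nlinarith

/-- The two decay estimates, by a joint induction: the `H¹` bound at one time level makes the
restriction on the time step effective for the next one. -/
lemma IsSolution.decay_estimates (h : IsSolution ν dt f ω ψ u v) (hν : 0 < ν) (hdt : 0 < dt)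
    (hf : ∀ n, normL2 (f n) ≤ F)
    (hstep : dt ≤ ν / (4 * advConst ^ 2 * constM (normH1 (ω 0)) ν F ^ 2)) (n : ℕ) :
    normL2 (ω n) ^ 2 ≤ decay ν dt ^ n * normL2 (ω 0) ^ 2
        + absorbL2 ν F * (1 - decay ν dt ^ n) ∧
      normH1 (ω n) ^ 2 ≤ decay ν dt ^ n * normH1 (ω 0) ^ 2
        + (constB ν F + decay ν dt ^ n * constA (normL2 (ω 0)) ν F)
          * (1 - decay ν dt ^ n) := by
  have hx : 0 < dampRate ν * dt := mul_pos (dampRate_pos hν) hdt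
  have hc0 := c0_pos
  have hD := absorbL2_nonneg ν F
  induction n with
  | zero => simp
  | succ n ih =>
    obtain ⟨ihL, ihH⟩ := ih
    obtain ⟨ht, ht1⟩ := decay_pow_mem hν hdt n
    have hE : normH1 (ω n) ^ 2 ≤ constM (normH1 (ω 0)) ν F ^ 2 :=
      normH1_sq_le_constM hν ht ht1 rfl (by rw [mul_pow]; exact h.poincare_L2 0) ihH
    have hres := step_restriction (one_le_constM _ _ _) hdt hstep hE
    have hx1 : dampRate ν * dt ≤ 1 := by
      refine dampRate_mul_le_one hν ?_ hdt hstep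
      unfold constM
      linarith [le_abs_self ν, abs_nonneg ν, sq_nonneg (normH1 (ω 0)), abs_nonneg (constB ν F),
        abs_nonneg (constA (c0 * normH1 (ω 0)) ν F)]
    have hL : normL2 (ω (n + 1)) ^ 2 ≤ decay ν dt * decay ν dt ^ n * normL2 (ω 0) ^ 2
        + absorbL2 ν F * (1 - decay ν dt * decay ν dt ^ n) := by
      refine gronwall_step hx decay_eq ?_ ihL
      have h1 := h.energy_L2 hν hdt hf n hres
      have h2 : dampRate ν * dt * normL2 (ω (n + 1)) ^ 2
          ≤ ν / 2 * dt * normH1 (ω (n + 1)) ^ 2 := by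
        calc _ ≤ dampRate ν * dt * (c0 ^ 2 * normH1 (ω (n + 1)) ^ 2) := by
              gcongr; exact h.poincare_L2 _
          _ = _ := by unfold dampRate; field_simp
      have h3 : dampRate ν * dt * absorbL2 ν F = c0 ^ 2 / ν * F ^ 2 * dt := by
        unfold dampRate absorbL2
        field_simp
      linarith
    refine ⟨by rw [pow_succ' (decay ν dt)]; exact hL, ?_⟩
    rw [pow_succ' (decay ν dt)]
    refine gronwall_step_transient hx hx1 decay_eq ht ht1 (sq_nonneg _) (constA_nonneg hν _ _)
      (constB_nonneg hν F) ?_ ihH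
    set t := decay ν dt ^ n
    -- a positive bound for the squared `L²` norm at both time levels
    set X := absorbL2 ν F + 1 + t * normL2 (ω 0) ^ 2 with hX
    have hX0 : 0 < X := by positivity
    have hXn : normL2 (ω n) ^ 2 ≤ X := by nlinarith
    have hXn' : normL2 (ω (n + 1)) ^ 2 ≤ X := by
      obtain ⟨hs, hs1⟩ := decay_pow_mem hν hdt 1
      rw [pow_one] at hs hs1
      have h1 : decay ν dt * t ≤ t := mul_le_of_le_one_left ht hs1
      have h2 : 0 ≤ decay ν dt * t := by positivity
      have h3 := mul_le_mul_of_nonneg_right h1 (sq_nonneg (normL2 (ω 0)))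
      nlinarith
    have h1 := h.energy_H1 hν hdt hf n hres hX0 hXn hXn'
    have h2 : 2 * (dampRate ν * dt) * normH1 (ω (n + 1)) ^ 2
        ≤ ν * dt * normH2 (ω (n + 1)) ^ 2 := by
      have := dampRate_pos hν
      calc _ ≤ 2 * (dampRate ν * dt) * (c0 ^ 2 * normH2 (ω (n + 1)) ^ 2) := by
            gcongr; exact poincare_H1 _
        _ = _ := by unfold dampRate; field_simp
    have h3 := advRate_add_le hν (by positivity : 0 ≤ absorbL2 ν F + 1)
      (sq_nonneg (normL2 (ω 0))) ht ht1
    have h4 : dampRate ν * dt * (constB ν F + t * (constA (normL2 (ω 0)) ν F / 2))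
        = dt * (advRate ν (absorbL2 ν F + 1) + 4 / ν * F ^ 2
          + t * advRate ν (absorbL2 ν F + 1 + normL2 (ω 0) ^ 2)) := by
      have := (dampRate_pos hν).ne'
      unfold constB constA
      field_simp
    have h5 : dt * (16384 * advConst ^ 4 / ν ^ 7 * X ^ 5 + 4 / ν * F ^ 2)
        ≤ dt * (advRate ν (absorbL2 ν F + 1) + 4 / ν * F ^ 2
          + t * advRate ν (absorbL2 ν F + 1 + normL2 (ω 0) ^ 2)) := by
      refine mul_le_mul_of_nonneg_left ?_ hdt.le
      have : 16384 * advConst ^ 4 / ν ^ 7 * X ^ 5 = advRate ν X := rfl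
      rw [this, hX]
      linarith
    linarith

end Solution

end CollocNS

theorem lemma4p2 :
    ∃ Cw : ℝ, 1 ≤ Cw ∧
    ∃ M₀ : ℝ → ℝ → ℝ → ℝ, (∀ a ν F, 0 < M₀ a ν F) ∧
    ∃ A K : ℝ → ℝ → ℝ → ℝ, ∃ B : ℝ → ℝ → ℝ,
    ∀ (N : ℕ) (ν dt F : ℝ) (f ω ψ u v : ℕ → CollocNS.Grid N),
      0 < ν → 0 < dt →
      (∀ n, CollocNS.MeanZero (f n)) →
      (∀ n, CollocNS.normL2 (f n) ≤ F) →
      CollocNS.MeanZero (ω 0) →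
      CollocNS.IsSolution ν dt f ω ψ u v →
      dt ≤ ν / (4 * Cw ^ 2 * M₀ (CollocNS.normH1 (ω 0)) ν F ^ 2) →
      -- uniform in time bounds
      (∀ n, CollocNS.normL2 (ω n) ≤ M₀ (CollocNS.normH1 (ω 0)) ν F ∧
        CollocNS.normH1 (ω n) ≤ M₀ (CollocNS.normH1 (ω 0)) ν F) ∧
      -- exponential decay in the discrete `L²` norm
      (∀ n, CollocNS.normL2 (ω n) ^ 2 ≤
        CollocNS.decay ν dt ^ n * CollocNS.normL2 (ω 0) ^ 2
          + 2 * CollocNS.c0 ^ 4 / ν ^ 2 * F ^ 2 * (1 - CollocNS.decay ν dt ^ n)) ∧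
      -- exponential decay in the discrete `H¹` norm
      (∀ n, CollocNS.normH1 (ω n) ^ 2 ≤
        CollocNS.decay ν dt ^ n * CollocNS.normH1 (ω 0) ^ 2
          + (B ν F + CollocNS.decay ν dt ^ n * A (CollocNS.normL2 (ω 0)) ν F)
            * (1 - CollocNS.decay ν dt ^ n)) ∧
      -- summed `H¹` bound
      (∀ i m : ℕ, 1 ≤ i → i ≤ m →
        ν / 2 * dt * ∑ n ∈ Finset.Icc i m, CollocNS.normH1 (ω n) ^ 2 ≤
          CollocNS.normL2 (ω (i - 1)) ^ 2
            + CollocNS.c0 ^ 2 / ν * F ^ 2 * ((m : ℝ) - i + 1) * dt) ∧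
      -- summed `H²` bound
      (∀ i m : ℕ, 1 ≤ i → i ≤ m →
        ν / 2 * dt * ∑ n ∈ Finset.Icc i m, CollocNS.normH2 (ω n) ^ 2 ≤
          CollocNS.normH1 (ω (i - 1)) ^ 2
            + K (CollocNS.normL2 (ω 0)) ν F * ((m : ℝ) - i + 1) * dt) := by
  refine ⟨CollocNS.advConst, CollocNS.one_le_advConst, CollocNS.constM,
    fun a ν F => zero_lt_one.trans_le (CollocNS.one_le_constM a ν F),
    CollocNS.constA, CollocNS.constK, CollocNS.constB, ?_⟩
  intro N ν dt F f ω ψ u v hν hdt _ hf _ h hstep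
  have hdec := h.decay_estimates hν hdt hf hstep
  have hM := CollocNS.one_le_constM (CollocNS.normH1 (ω 0)) ν F
  have hM0 := zero_le_one.trans hM
  have hE : ∀ n, CollocNS.normH1 (ω n) ^ 2
      ≤ CollocNS.constM (CollocNS.normH1 (ω 0)) ν F ^ 2 := fun n => by
    obtain ⟨ht, ht1⟩ := CollocNS.decay_pow_mem hν hdt n
    exact CollocNS.normH1_sq_le_constM hν ht ht1 rfl
      (by rw [mul_pow]; exact h.poincare_L2 0) (hdec n).2
  have hres := fun n => CollocNS.step_restriction hM hdt hstep (hE n)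
  refine ⟨fun n => ⟨?_, ?_⟩, fun n => (hdec n).1, fun n => (hdec n).2, ?_, ?_⟩
  · refine le_of_sq_le_sq ?_ hM0
    have h1 := h.poincare_L2 n
    have h2 := mul_le_of_le_one_left (sq_nonneg (CollocNS.normH1 (ω n))) CollocNS.c0_sq_le_one
    exact h1.trans (h2.trans (hE n))
  · exact le_of_sq_le_sq (hE n) hM0
  · intro i m hi him
    have := CollocNS.sum_le_of_step (y := fun n => CollocNS.normL2 (ω n) ^ 2)
      (g := fun n => CollocNS.normH1 (ω n) ^ 2) (fun n => sq_nonneg _)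
      (fun n => h.energy_L2 hν hdt hf n (hres n)) hi him
    linarith
  · intro i m hi him
    set X := CollocNS.absorbL2 ν F + 1 + CollocNS.normL2 (ω 0) ^ 2 with hX
    have hD := CollocNS.absorbL2_nonneg ν F
    have hX0 : 0 < X := by positivity
    have hLX : ∀ n, CollocNS.normL2 (ω n) ^ 2 ≤ X := fun n => by
      obtain ⟨ht, ht1⟩ := CollocNS.decay_pow_mem hν hdt n
      have h1 := mul_le_of_le_one_left (sq_nonneg (CollocNS.normL2 (ω 0))) ht1
      have h2 := mul_le_of_le_one_right hD (by linarith : 1 - CollocNS.decay ν dt ^ n ≤ 1)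
      linarith [(hdec n).1]
    have := CollocNS.sum_le_of_step (y := fun n => CollocNS.normH1 (ω n) ^ 2)
      (g := fun n => CollocNS.normH2 (ω n) ^ 2) (c := ν / 2 * dt)
      (k := CollocNS.constK (CollocNS.normL2 (ω 0)) ν F * dt) (fun n => sq_nonneg _)
      (fun n => ?_) hi him
    · linarith
    · have h1 := h.energy_H1 hν hdt hf n (hres n) hX0 (hLX n) (hLX (n + 1))
      have h2 : 0 ≤ ν / 2 * dt * CollocNS.normH2 (ω (n + 1)) ^ 2 := by positivity
      have h3 : 16384 * CollocNS.advConst ^ 4 / ν ^ 7 * X ^ 5 + 4 / ν * F ^ 2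
          = CollocNS.constK (CollocNS.normL2 (ω 0)) ν F := rfl
      rw [h3] at h1
      linarith
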